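/- Let $\psi:\mathbb{N}=\{1,2,\dots\}\to\mathbb{R}$ be a non-negative function, let $\varphi$ be Euler's totient function and $\lambda$ the Lebesgue (probability) measure on $\mathbb{R}/\mathbb{Z}$. For $n\ge 1$ let $\mathcal{E}_n\subset\mathbb{R}/\mathbb{Z}$ be the union, over all integers $1\le a\le n$ with $\gcd(a,n)=1$, of the images modulo $1$ of the open intervals $\left(\frac{a-\psi(n)}{n},\frac{a+\psi(n)}{n}\right)$, and let $$W(\psi)=\bigcap_{N=1}^\infty\bigcup_{n=N}^\infty\mathcal{E}_n .$$ For $h\ge 1$ set $$\Delta_h=\{2^{2^h}+1,\dots,2^{2^{h+1}}\}\qquad\text{and}\qquad S_h=\sum_{n\in\Delta_h}\frac{\psi(n)\varphi(n)}{n}.$$ Suppose that $\sum_{n=1}^\infty \frac{\psi(n)\varphi(n)}{n}=\infty$ and that there is a constant $c$ such that $S_h\le c/h$ for all $h\ge 1$. Then $\lambda(W(\psi))=1$. Equivalently, for Lebesgue-almost every real number $x$ the inequality $|nx-a|<\psi(n)$ has infinitely many solutions $(a,n)$ with $a\in\mathbb{Z}$, $n\ge 1$ and $\gcd(a,n)=1$.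 -/

import Mathlib

open MeasureTheory

namespace DuffinSchaeffer

/-- The set `E_n ⊆ ℝ/ℤ`: the union, over the `1 ≤ a ≤ n` coprime to `n`, of the images in `ℝ/ℤ` of
the open intervals `((a - ψ n) / n, (a + ψ n) / n)`. -/
def E (ψ : ℕ → ℝ) (n : ℕ) : Set UnitAddCircle :=
  ⋃ a : ℕ, ⋃ _ : 1 ≤ a ∧ a ≤ n ∧ Nat.Coprime a n,
    (fun x : ℝ => (x : UnitAddCircle)) '' Set.Ioo (((a : ℝ) - ψ n) / n) (((a : ℝ) + ψ n) / n)

/-- The limsup set `W(ψ) = ⋂_{N ≥ 1} ⋃_{n ≥ N} E_n` in `ℝ/ℤ`. -/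
def W (ψ : ℕ → ℝ) : Set UnitAddCircle :=
  ⋂ N : ℕ, ⋂ _ : 1 ≤ N, ⋃ n : ℕ, ⋃ _ : N ≤ n, E ψ n

/-- The pairs `(a, n)` with `a ∈ ℤ` and `n ≥ 1` coprime such that `|n x - a| < ψ n`. -/
def coprimeSolutions (ψ : ℕ → ℝ) (x : ℝ) : Set (ℤ × ℕ) :=
  {p | 1 ≤ p.2 ∧ Int.gcd p.1 (p.2 : ℤ) = 1 ∧ |(p.2 : ℝ) * x - (p.1 : ℝ)| < ψ p.2}

/-- The block `Δ_h = {2^(2^h) + 1, …, 2^(2^(h+1))}`. -/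
def Δ (h : ℕ) : Finset ℕ := Finset.Icc (2 ^ (2 ^ h) + 1) (2 ^ (2 ^ (h + 1)))

/-- The block sum `S_h = ∑_{n ∈ Δ_h} ψ(n) φ(n) / n`. -/
noncomputable def S (ψ : ℕ → ℝ) (h : ℕ) : ℝ :=
  ∑ n ∈ Δ h, ψ n * (Nat.totient n : ℝ) / (n : ℝ)

end DuffinSchaeffer

/-!
The set `E_n` is, up to the choice of representatives, the set of points of `ℝ/ℤ` within `ψ(n) / n`
of a point of order `n`, so Gallagher's zero-one law
(`AddCircle.addWellApproximable_ae_empty_or_univ`) reduces the claim to `λ(W(ψ)) > 0`. Positivity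
follows from the second moment method (`le_measureReal_biUnion_of_pairwise_le`) once the overlaps
`λ(E_m ∩ E_n)`, summed over `m` and `n` in a range with `∑ ψ(n) φ(n) / n = T ≥ 1`, are `O(T²)`.

Write `s_n = ψ(n) φ(n) / n`. An overlap is controlled by the number of pairs (point of order `m`,
point of order `n`) at distance less than `δ = ψ(m) / m + ψ(n) / n`
(`volume_real_inter_le_card_closePairs`). There are two estimates for this number.

* For all `m ≠ n`, the difference of such a pair is a nonzero `lcm m n`-torsion point of norm less
  than `δ`, and each point is a difference in at most `φ(gcd m n)` ways (`card_filter_sub_le`).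
  Together with `L / φ(L) ≪ log log L` for `L = lcm m n` this gives `λ(E_m ∩ E_n) ≪ h s_m s_n` when
  `m`, `n` lie in blocks of index at most `h` (`exists_near_overlap_le`).
* If `n` lies at least three blocks above `m`, the points of order `n` near a fixed point can be
  counted by sieving by the primes `p ∣ n` with `p ≪ log n` alone. The product `q` of these primes is
  a small power of `n`, while `φ(q) / q` is comparable to `φ(n) / n`. This gives
  `λ(E_m ∩ E_n) ≪ s_m s_n` (`far_overlap_le`).

The hypothesis `S_h ≤ c / h` cancels the loss of `h` for neighbouring blocks: their total overlap is
`≪ ∑ h S_h² ≪ ∑ S_h = T ≤ T²` (`exists_sum_blockOverlap_le`). The bound `n / φ(n) ≪ log log n` comes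
from an upper bound of Mertens' type for `∏ (1 - 1 / p)⁻¹`, which is proved by comparing with
`ζ(1 + 1 / H)`. Before all this, `ψ` is scaled down and truncated (`exists_truncation`) so that the
balls making up one `E_n` are disjoint and no nonempty `E_n` is too thin for the sieve.
-/

namespace DuffinSchaeffer

/-! ### Prime products and the size of `n / φ(n)` -/

lemma sum_log_div_primesBelow_le (H : ℕ) :
    ∑ p ∈ Nat.primesBelow (2 ^ H + 1), Real.log p / p ≤ 4 * Real.log 2 * H := by
  induction H with
  | zero =>
    simp
  | succ H ih =>
    have hsub : Nat.primesBelow (2 ^ H + 1) ⊆ Nat.primesBelow (2 ^ (H + 1) + 1) := by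
      intro p hp
      rw [Nat.mem_primesBelow] at hp ⊢
      exact ⟨by rw [pow_succ]; omega, hp.2⟩
    rw [← Finset.sum_sdiff hsub]
    have hblock : ∑ p ∈ Nat.primesBelow (2 ^ (H + 1) + 1) \ Nat.primesBelow (2 ^ H + 1),
        Real.log p / p ≤ 4 * Real.log 2 := by
      calc _ ≤ ∑ p ∈ Nat.primesBelow (2 ^ (H + 1) + 1) \ Nat.primesBelow (2 ^ H + 1),
            Real.log p / 2 ^ H := by
            refine Finset.sum_le_sum fun p hp => ?_
            simp only [Finset.mem_sdiff, Nat.mem_primesBelow, not_and] at hp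
            have h1 : 2 ^ H ≤ p := by
              by_contra h
              exact hp.2 (by omega) hp.1.2
            have h2 : (2 : ℝ) ^ H ≤ p := by exact_mod_cast h1
            exact div_le_div_of_nonneg_left (Real.log_natCast_nonneg p) (by positivity) h2
        _ = (∑ p ∈ Nat.primesBelow (2 ^ (H + 1) + 1) \ Nat.primesBelow (2 ^ H + 1),
            Real.log p) / 2 ^ H := by rw [Finset.sum_div]
        _ ≤ (∑ p ∈ Nat.primesLE (2 ^ (H + 1)), Real.log p) / 2 ^ H := by
            refine div_le_div_of_nonneg_right ?_ (by positivity)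
            refine Finset.sum_le_sum_of_subset_of_nonneg ?_
              fun p _ _ => Real.log_natCast_nonneg p
            exact Finset.sdiff_subset
        _ ≤ (Real.log 4 * (2 ^ (H + 1) : ℕ)) / 2 ^ H := by
            rw [← Chebyshev.theta_eq_sum_primesLE_log]
            exact div_le_div_of_nonneg_right (Chebyshev.theta_le_log4_mul_x (by positivity))
              (by positivity)
        _ = 4 * Real.log 2 := by
            rw [show (4 : ℝ) = 2 ^ 2 by norm_num, Real.log_pow]
            push_cast
            field_simp
            ring
    push_cast
    linarith

lemma one_le_inv_one_sub_inv {p : ℕ} (hp : p.Prime) : 1 ≤ (1 - (p : ℝ)⁻¹)⁻¹ := by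
  have hp2 : (2 : ℝ) ≤ p := by exact_mod_cast hp.two_le
  have : (p : ℝ)⁻¹ ≤ 2⁻¹ := inv_anti₀ (by norm_num) hp2
  have : (0 : ℝ) < (p : ℝ)⁻¹ := by positivity
  exact (one_le_inv₀ (by linarith)).2 (by linarith)

lemma one_le_prod_inv_one_sub_inv {s : Finset ℕ} (hs : ∀ p ∈ s, p.Prime) :
    1 ≤ ∏ p ∈ s, (1 - (p : ℝ)⁻¹)⁻¹ :=
  (Finset.prod_const_one (s := s) (M := ℝ)).symm.le.trans <|
    Finset.prod_le_prod (fun _ _ => zero_le_one) fun p hp => one_le_inv_one_sub_inv (hs p hp)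

lemma prod_inv_one_sub_inv_mono {s t : Finset ℕ} (ht : ∀ p ∈ t, p.Prime) (h : s ⊆ t) :
    ∏ p ∈ s, (1 - (p : ℝ)⁻¹)⁻¹ ≤ ∏ p ∈ t, (1 - (p : ℝ)⁻¹)⁻¹ := by
  rw [← Finset.prod_sdiff h]
  refine le_mul_of_one_le_left ?_ ?_
  · exact zero_le_one.trans (one_le_prod_inv_one_sub_inv fun p hp => ht p (h hp))
  · exact one_le_prod_inv_one_sub_inv fun p hp => ht p (Finset.sdiff_subset hp)

/-- Passing from the exponent `1` to `1 + 1 / H` in an Euler factor costs `exp (2 log p / (H p))`. -/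
lemma inv_one_sub_inv_le_exp_mul {p : ℕ} (hp : p.Prime) {H : ℝ} (hH : 0 < H) :
    (1 - (p : ℝ)⁻¹)⁻¹ ≤
      Real.exp (2 / H * (Real.log p / p)) * (1 - (p : ℝ) ^ (-(1 + 1 / H)))⁻¹ := by
  have hp2 : (2 : ℝ) ≤ p := by exact_mod_cast hp.two_le
  have hp0 : (0 : ℝ) < p := by linarith
  set x : ℝ := (p : ℝ)⁻¹ with hx
  set u : ℝ := Real.log p / H with hu
  have hx0 : 0 < x := by positivity
  have hx2 : x ≤ 1 / 2 := by
    rw [hx, one_div]; exact inv_anti₀ (by norm_num) hp2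
  have hu0 : 0 ≤ u := div_nonneg (Real.log_natCast_nonneg p) hH.le
  have hy : (p : ℝ) ^ (-(1 + 1 / H)) = x * Real.exp (-u) := by
    rw [neg_add, Real.rpow_add hp0, Real.rpow_neg_one, Real.rpow_def_of_pos hp0]
    congr 2
    rw [hu]; ring
  have hyl : x * (1 - u) ≤ x * Real.exp (-u) :=
    mul_le_mul_of_nonneg_left (by linarith [Real.add_one_le_exp (-u)]) hx0.le
  have hyu : x * Real.exp (-u) ≤ x :=
    mul_le_of_le_one_right hx0.le (Real.exp_le_one_iff.2 (by linarith))
  have he : 2 / H * (Real.log p / p) = 2 * x * u := by rw [hx, hu]; field_simp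
  rw [hy, he, ← div_eq_mul_inv, le_div_iff₀ (by linarith), inv_mul_le_iff₀ (by linarith)]
  have h1 : 1 + 2 * x * u ≤ Real.exp (2 * x * u) := by
    linarith [Real.add_one_le_exp (2 * x * u)]
  have h2 : (1 - x) * (1 + 2 * x * u) ≤ (1 - x) * Real.exp (2 * x * u) :=
    mul_le_mul_of_nonneg_left h1 (by linarith)
  nlinarith [mul_nonneg hx0.le hu0, mul_nonneg (mul_nonneg hx0.le hu0) (sub_nonneg.2 hx2)]

/-- The product over primes of `(1 - p ^ (-σ))⁻¹` is at most `ζ(σ)`. -/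
lemma prod_primesBelow_inv_one_sub_rpow_le {σ : ℝ} (hσ : 1 < σ) (N : ℕ) :
    ∏ p ∈ N.primesBelow, (1 - (p : ℝ) ^ (-σ))⁻¹ ≤ ∑' n : ℕ, 1 / (n : ℝ) ^ σ := by
  let f : ℕ →* ℝ :=
    { toFun := fun n => (n : ℝ) ^ (-σ)
      map_one' := by simp
      map_mul' := fun a b => by
        push_cast
        exact Real.mul_rpow (Nat.cast_nonneg a) (Nat.cast_nonneg b) }
  have hs : Summable (f : ℕ → ℝ) := Real.summable_nat_rpow.2 (by linarith)
  have hf : ∀ n, f n = 1 / (n : ℝ) ^ σ := fun n => by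
    change (n : ℝ) ^ (-σ) = _
    rw [Real.rpow_neg (Nat.cast_nonneg n), one_div]
  have := EulerProduct.prod_primesBelow_geometric_eq_tsum_smoothNumbers hs N
  calc _ = ∑' m : N.smoothNumbers, f m := this
    _ ≤ ∑' n : ℕ, f n := by
        refine Summable.tsum_subtype_le (f : ℕ → ℝ) _ (fun n => ?_) hs
        rw [hf]; positivity
    _ = _ := tsum_congr hf

/-- An upper bound of Mertens' type. -/
lemma exists_prod_primesBelow_le :
    ∃ C : ℝ, 0 < C ∧ ∀ H : ℕ, 1 ≤ H →
      ∏ p ∈ Nat.primesBelow (2 ^ H + 1), (1 - (p : ℝ)⁻¹)⁻¹ ≤ C * H := by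
  -- `ζ(1 + 1 / H) ≤ 2 H` for large `H`
  have hζ : ∀ᶠ H : ℕ in Filter.atTop,
      ∑' n : ℕ, 1 / (n : ℝ) ^ (1 + 1 / (H : ℝ)) ≤ 2 * H := by
    have hlim : Filter.Tendsto (fun H : ℕ => 1 + 1 / (H : ℝ)) Filter.atTop
        (nhdsWithin 1 (Set.Ioi 1)) := by
      refine tendsto_nhdsWithin_iff.2 ⟨?_, ?_⟩
      · simpa using (tendsto_one_div_atTop_nhds_zero_nat (𝕜 := ℝ)).const_add 1
      · filter_upwards [Filter.eventually_gt_atTop 0] with H hH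
        have : (0 : ℝ) < H := by exact_mod_cast hH
        simpa using this
    filter_upwards [(tendsto_sub_mul_tsum_nat_rpow.comp hlim).eventually_le_const
      (show (1 : ℝ) < 2 by norm_num), Filter.eventually_gt_atTop 0] with H hH hH0
    have hH0 : (0 : ℝ) < H := by exact_mod_cast hH0
    simp only [Function.comp_apply, add_sub_cancel_left] at hH
    rw [one_div, inv_mul_le_iff₀ hH0] at hH
    simpa [mul_comm] using hH
  obtain ⟨H₀, hH₀⟩ := Filter.eventually_atTop.1 hζ
  set K : ℝ := Real.exp (8 * Real.log 2) * 2
  have hK : 0 ≤ K := by positivity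
  have hbig : ∀ H : ℕ, 1 ≤ H → H₀ ≤ H →
      ∏ p ∈ Nat.primesBelow (2 ^ H + 1), (1 - (p : ℝ)⁻¹)⁻¹ ≤ K * H := by
    intro H h1 hH
    have hH0 : (0 : ℝ) < H := by exact_mod_cast h1
    have hσ : 1 < 1 + 1 / (H : ℝ) := by
      have : 0 < 1 / (H : ℝ) := by positivity
      linarith
    calc _ ≤ ∏ p ∈ Nat.primesBelow (2 ^ H + 1), Real.exp (2 / H * (Real.log p / p)) *
          (1 - (p : ℝ) ^ (-(1 + 1 / (H : ℝ))))⁻¹ := by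
          refine Finset.prod_le_prod (fun p hp => ?_) fun p hp => ?_
          · exact zero_le_one.trans (one_le_inv_one_sub_inv (Nat.prime_of_mem_primesBelow hp))
          · exact inv_one_sub_inv_le_exp_mul (Nat.prime_of_mem_primesBelow hp) hH0
      _ = Real.exp (2 / H * ∑ p ∈ Nat.primesBelow (2 ^ H + 1), Real.log p / p) *
          ∏ p ∈ Nat.primesBelow (2 ^ H + 1), (1 - (p : ℝ) ^ (-(1 + 1 / (H : ℝ))))⁻¹ := by
          rw [Finset.prod_mul_distrib, ← Real.exp_sum, ← Finset.mul_sum]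
      _ ≤ Real.exp (8 * Real.log 2) * (2 * H) := by
          refine mul_le_mul (Real.exp_le_exp.2 ?_)
            ((prod_primesBelow_inv_one_sub_rpow_le hσ _).trans (hH₀ H hH)) ?_ (by positivity)
          · calc _ ≤ 2 / (H : ℝ) * (4 * Real.log 2 * H) :=
                  mul_le_mul_of_nonneg_left (sum_log_div_primesBelow_le H) (by positivity)
              _ = 8 * Real.log 2 := by field_simp; ring
          · refine Finset.prod_nonneg fun p hp => inv_nonneg.2 (sub_nonneg.2 ?_)
            have := (Nat.prime_of_mem_primesBelow hp).one_lt
            exact Real.rpow_le_one_of_one_le_of_nonpos (by exact_mod_cast this.le) (by linarith)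
      _ = K * H := by ring
  refine ⟨K * (H₀ + 1), by positivity, fun H h1 => ?_⟩
  have hH1 : (1 : ℝ) ≤ H := by exact_mod_cast h1
  calc _ ≤ ∏ p ∈ Nat.primesBelow (2 ^ (H + H₀) + 1), (1 - (p : ℝ)⁻¹)⁻¹ := by
        refine prod_inv_one_sub_inv_mono (fun p hp => Nat.prime_of_mem_primesBelow hp)
          fun p hp => ?_
        rw [Nat.mem_primesBelow] at hp ⊢
        have : 2 ^ H ≤ 2 ^ (H + H₀) := Nat.pow_le_pow_right (by norm_num) (by omega)
        exact ⟨by omega, hp.2⟩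
    _ ≤ K * (H + H₀ : ℕ) := hbig _ (by omega) (by omega)
    _ ≤ K * (H₀ + 1) * H := by
        refine (mul_le_mul_of_nonneg_left (c := ((H₀ : ℝ) + 1) * H) ?_ hK).trans_eq (by ring)
        push_cast
        nlinarith [(Nat.cast_nonneg H₀ : (0 : ℝ) ≤ H₀)]

lemma card_primeFactors_le {n H : ℕ} (hn : n ≠ 0) (h : n ≤ 2 ^ H) : n.primeFactors.card ≤ H := by
  have h1 : 2 ^ n.primeFactors.card ≤ ∏ p ∈ n.primeFactors, p :=
    Finset.pow_card_le_prod _ _ _ fun p hp => (Nat.prime_of_mem_primeFactors hp).two_le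
  have h2 : ∏ p ∈ n.primeFactors, p ≤ n := Nat.le_of_dvd (Nat.pos_of_ne_zero hn)
    (Nat.prod_primeFactors_dvd n)
  exact (Nat.pow_le_pow_iff_right one_lt_two).1 (h1.trans (h2.trans h))

lemma cast_eq_totient_mul_prod (n : ℕ) :
    (n : ℝ) = n.totient * ∏ p ∈ n.primeFactors, (1 - (p : ℝ)⁻¹)⁻¹ := by
  have h : ((n.totient : ℚ) : ℝ) = ((n * ∏ p ∈ n.primeFactors, (1 - (p : ℚ)⁻¹) : ℚ) : ℝ) := by
    rw [Nat.totient_eq_mul_prod_factors]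
  push_cast at h
  rw [h, mul_assoc, ← Finset.prod_mul_distrib, Finset.prod_eq_one, mul_one]
  intro p hp
  have hp2 : (2 : ℝ) ≤ p := by exact_mod_cast (Nat.prime_of_mem_primeFactors hp).two_le
  have : (p : ℝ)⁻¹ ≤ 2⁻¹ := inv_anti₀ (by norm_num) hp2
  exact mul_inv_cancel₀ (by norm_num at this; linarith)

lemma prod_large_primeFactors_le {n H y : ℕ} (hn : n ≠ 0) (h : n ≤ 2 ^ H) (hy : 1 ≤ y) :
    ∏ p ∈ n.primeFactors with ¬ p ≤ y, (1 - (p : ℝ)⁻¹)⁻¹ ≤ Real.exp (H / y) := by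
  have hy0 : (0 : ℝ) < y := by exact_mod_cast hy
  calc _ ≤ ∏ p ∈ n.primeFactors with ¬ p ≤ y, Real.exp (1 / y) := by
        refine Finset.prod_le_prod (fun p hp => ?_) fun p hp => ?_
        all_goals
          simp only [Finset.mem_filter, not_le] at hp
          have hp1 : (y : ℝ) + 1 ≤ p := by exact_mod_cast hp.2
        · have : (p : ℝ)⁻¹ ≤ 1 := inv_le_one_of_one_le₀ (by linarith)
          exact inv_nonneg.2 (by linarith)
        · have h1 : (1 - (p : ℝ)⁻¹)⁻¹ ≤ 1 + 1 / y := by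
            have h2 : (1 - (p : ℝ)⁻¹)⁻¹ = p / (p - 1) := by
              rw [← inv_div, sub_div, div_self (by linarith), one_div]
            rw [h2, div_le_iff₀ (by linarith)]
            have : (1 : ℝ) ≤ 1 / y * (p - 1) := by
              rw [div_mul_eq_mul_div, one_mul, one_le_div hy0]; linarith
            linarith
          linarith [Real.add_one_le_exp (1 / (y : ℝ))]
    _ = Real.exp ((n.primeFactors.filter (¬ · ≤ y)).card * (1 / y)) := by
        rw [Finset.prod_const, ← Real.exp_nat_mul]
    _ ≤ _ := by
        refine Real.exp_le_exp.2 ?_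
        rw [mul_one_div]
        refine div_le_div_of_nonneg_right ?_ hy0.le
        exact_mod_cast (Finset.card_filter_le _ _).trans (card_primeFactors_le hn h)

/-- The order of magnitude `n / φ(n) ≪ log log n`. -/
lemma exists_le_mul_totient :
    ∃ C : ℝ, 0 < C ∧ ∀ H n : ℕ, 1 ≤ H → n ≠ 0 → n ≤ 2 ^ 2 ^ H → (n : ℝ) ≤ C * H * n.totient := by
  obtain ⟨C, hC, hP⟩ := exists_prod_primesBelow_le
  refine ⟨C * Real.exp 1, by positivity, fun H n hH hn h => ?_⟩
  have hsmall : ∏ p ∈ n.primeFactors with p ≤ 2 ^ H, (1 - (p : ℝ)⁻¹)⁻¹ ≤ C * H := by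
    refine le_trans (prod_inv_one_sub_inv_mono
      (fun p hp => Nat.prime_of_mem_primesBelow hp) fun p hp => ?_) (hP H hH)
    rw [Finset.mem_filter] at hp
    exact Nat.mem_primesBelow.2 ⟨by omega, Nat.prime_of_mem_primeFactors hp.1⟩
  have hlarge := prod_large_primeFactors_le (y := 2 ^ H) hn h Nat.one_le_two_pow
  rw [div_self (by positivity)] at hlarge
  have hpos : 0 ≤ ∏ p ∈ n.primeFactors with ¬ p ≤ 2 ^ H, (1 - (p : ℝ)⁻¹)⁻¹ :=
    zero_le_one.trans (one_le_prod_inv_one_sub_inv fun p hp =>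
      Nat.prime_of_mem_primeFactors (Finset.mem_filter.1 hp).1)
  conv_lhs => rw [cast_eq_totient_mul_prod n,
    ← Finset.prod_filter_mul_prod_filter_not n.primeFactors (· ≤ 2 ^ H)]
  rw [mul_comm]
  refine mul_le_mul_of_nonneg_right ?_ (Nat.cast_nonneg _)
  calc _ ≤ C * H * Real.exp 1 := mul_le_mul hsmall hlarge hpos (by positivity)
    _ = _ := by ring

/-- A divisor `q` of `n` composed of small primes has `φ(q) / q` comparable to `φ(n) / n`. -/
lemma exists_dvd_totient_mul_le {n H y : ℕ} (hn : n ≠ 0) (h : n ≤ 2 ^ H) (hy : 1 ≤ y) :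
    ∃ q : ℕ, q ∣ n ∧ q ≤ 4 ^ y ∧
      (q.totient : ℝ) * n ≤ Real.exp (H / y) * n.totient * q := by
  set s := n.primeFactors.filter (· ≤ y)
  have hs : ∀ p ∈ s, p.Prime := fun p hp =>
    Nat.prime_of_mem_primeFactors (Finset.mem_filter.1 hp).1
  refine ⟨∏ p ∈ s, p, ?_, ?_, ?_⟩
  · exact (Finset.prod_dvd_prod_of_subset _ _ _ (Finset.filter_subset _ _)).trans
      (Nat.prod_primeFactors_dvd n)
  · refine le_trans ?_ (primorial_le_four_pow y)
    refine Nat.le_of_dvd (primorial_pos y) ?_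
    rw [primorial_eq_prod_primesLE]
    refine Finset.prod_dvd_prod_of_subset _ _ _ fun p hp => ?_
    exact Nat.mem_primesLE.2 ⟨(Finset.mem_filter.1 hp).2, hs p hp⟩
  · have hlarge := prod_large_primeFactors_le hn h hy
    set q := ∏ p ∈ s, p
    have hq : q.primeFactors = s := Nat.primeFactors_prod hs
    have hqe := cast_eq_totient_mul_prod q
    have hne := cast_eq_totient_mul_prod n
    rw [hq] at hqe
    rw [← Finset.prod_filter_mul_prod_filter_not n.primeFactors (· ≤ y)] at hne
    have hpos : 0 ≤ ∏ p ∈ s, (1 - (p : ℝ)⁻¹)⁻¹ :=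
      zero_le_one.trans (one_le_prod_inv_one_sub_inv hs)
    set A := ∏ p ∈ s, (1 - (p : ℝ)⁻¹)⁻¹
    rw [hne, hqe]
    have := mul_le_mul_of_nonneg_left hlarge
      (show 0 ≤ (q.totient : ℝ) * n.totient * A by positivity)
    calc _ = (q.totient : ℝ) * n.totient * A * _ := by ring
      _ ≤ _ := this
      _ = _ := by ring

/-! ### Counting close pairs of torsion points -/

/-- The points `a / n` of `ℝ/ℤ` with `a` coprime to `n`; for `n ≥ 1` these are exactly the points
of order `n`. -/
noncomputable def reducedPoints (n : ℕ) : Finset UnitAddCircle :=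
  ((Finset.range n).filter n.Coprime).image fun a : ℕ => (((a : ℝ) / n : ℝ) : UnitAddCircle)

lemma mem_reducedPoints {n : ℕ} (hn : 0 < n) {y : UnitAddCircle} :
    y ∈ reducedPoints n ↔ addOrderOf y = n := by
  rw [AddCircle.addOrderOf_eq_pos_iff hn]
  simp only [reducedPoints, Finset.mem_image, Finset.mem_filter, Finset.mem_range, mul_one,
    Nat.coprime_comm (n := n), Nat.Coprime, and_assoc]

lemma card_reducedPoints {n : ℕ} (hn : 0 < n) : (reducedPoints n).card = n.totient := by
  rw [← AddCircle.card_addOrderOf_eq_totient (p := (1 : ℝ)),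
    Nat.subtype_card _ fun y => mem_reducedPoints hn]

/-- With `m = g m'` and `p ∣ m`, the points `k / g` and `a / m` have the same multiple by `m / p` as
soon as `m' k ≡ a` modulo `p`. -/
lemma nsmul_div_eq_nsmul_div {g m' p c k a : ℕ} (hg : g ≠ 0) (hm' : m' ≠ 0) (hp : p ≠ 0)
    (hc : g * m' = p * c) (h : m' * k ≡ a [MOD p]) :
    c • (((k : ℝ) / g : ℝ) : UnitAddCircle) = c • (((a : ℝ) / (g * m' : ℕ) : ℝ) : UnitAddCircle) := by
  obtain ⟨j, hj⟩ := (Nat.modEq_iff_dvd.1 h)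
  have hj' : (a : ℝ) - m' * k = p * j := by exact_mod_cast hj
  have hc' : (g : ℝ) * m' = p * c := by exact_mod_cast hc
  have hg0 : (g : ℝ) ≠ 0 := by exact_mod_cast hg
  have hm0 : (m' : ℝ) ≠ 0 := by exact_mod_cast hm'
  have hp0 : (p : ℝ) ≠ 0 := by exact_mod_cast hp
  rw [← AddCircle.coe_nsmul, ← AddCircle.coe_nsmul, eq_comm, ← sub_eq_zero, ← AddCircle.coe_sub,
    AddCircle.coe_eq_zero_iff]
  refine ⟨j, ?_⟩
  rw [zsmul_eq_mul, mul_one, nsmul_eq_mul, nsmul_eq_mul]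
  push_cast
  have hc2 : (c : ℝ) = g * m' / p := by field_simp; linarith
  rw [hc2]
  field_simp
  linarith

/-- A local-to-global step: there is a `gcd m n`-torsion point that at each prime `p` dividing
`gcd m n` has the same `p`-component as `y` or the same `p`-component as `z`. -/
lemma exists_torsion_interpolating {m n : ℕ} (hm : 0 < m) (hn : 0 < n) {y z : UnitAddCircle}
    (hy : addOrderOf y = m) (hz : addOrderOf z = n) :
    ∃ e : UnitAddCircle, (m.gcd n) • e = 0 ∧ ∀ p : ℕ, p.Prime → p ∣ m.gcd n →
      (m / p) • e = (m / p) • y ∨ (n / p) • e = (n / p) • z := by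
  obtain ⟨a, -, -, rfl⟩ := (AddCircle.addOrderOf_eq_pos_iff hm).1 hy
  obtain ⟨b, -, -, rfl⟩ := (AddCircle.addOrderOf_eq_pos_iff hn).1 hz
  set g := m.gcd n with hgdef
  have hg : 0 < g := Nat.gcd_pos_of_pos_left _ hm
  obtain ⟨m', hm'⟩ : g ∣ m := Nat.gcd_dvd_left m n
  obtain ⟨n', hn'⟩ : g ∣ n := Nat.gcd_dvd_right m n
  have hcop : m'.Coprime n' := by
    have := Nat.coprime_div_gcd_div_gcd (m := m) (n := n) hg
    rwa [← hgdef, Nat.div_eq_of_eq_mul_right hg hm', Nat.div_eq_of_eq_mul_right hg hn'] at this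
  have hm0 : m' ≠ 0 := by rintro rfl; simp at hm'; omega
  have hn0 : n' ≠ 0 := by rintro rfl; simp at hn'; omega
  have key : ∀ p : ℕ, ∃ E : ℕ, p.Prime → m' * E ≡ a [MOD p] ∨ n' * E ≡ b [MOD p] := by
    have solve : ∀ p c d : ℕ, p.Prime → ¬ p ∣ c → ∃ E : ℕ, c * E ≡ d [MOD p] := by
      intro p c d hp hc
      have := Fact.mk hp
      refine ⟨((c : ZMod p)⁻¹ * d : ZMod p).val, ?_⟩
      rw [← ZMod.natCast_eq_natCast_iff]
      push_cast
      rw [ZMod.natCast_zmod_val, mul_inv_cancel_left₀]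
      rwa [Ne, ZMod.natCast_eq_zero_iff]
    intro p
    by_cases hp : p.Prime
    · by_cases h : p ∣ m'
      · obtain ⟨E, hE⟩ := solve p n' b hp fun h2 => hp.one_lt.ne'
          (Nat.eq_one_of_dvd_coprimes hcop h h2)
        exact ⟨E, fun _ => Or.inr hE⟩
      · obtain ⟨E, hE⟩ := solve p m' a hp h
        exact ⟨E, fun _ => Or.inl hE⟩
    · exact ⟨0, fun h => (hp h).elim⟩
  choose f hf using key
  obtain ⟨k, hk⟩ := Nat.chineseRemainderOfFinset f id g.primeFactors
    (fun p hp => (Nat.prime_of_mem_primeFactors hp).ne_zero)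
    (fun p hp q hq hpq => (Nat.coprime_primes (Nat.prime_of_mem_primeFactors hp)
      (Nat.prime_of_mem_primeFactors hq)).2 hpq)
  refine ⟨(((k : ℝ) / g : ℝ) : UnitAddCircle), ?_, fun p hp hpg => ?_⟩
  · rw [← AddCircle.coe_nsmul, AddCircle.coe_eq_zero_iff]
    refine ⟨k, ?_⟩
    have : (g : ℝ) ≠ 0 := by exact_mod_cast hg.ne'
    simp
    field_simp
  · have hkp : k ≡ f p [MOD p] := hk p (Nat.mem_primeFactors.2 ⟨hp, hpg, hg.ne'⟩)
    simp only [mul_one]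
    refine (hf p hp).imp (fun h => ?_) fun h => ?_
    · have := nsmul_div_eq_nsmul_div hg.ne' hm0 hp.ne_zero (c := m / p)
        (by rw [← hm', Nat.mul_div_cancel' (hpg.trans ⟨m', hm'⟩)]) ((hkp.mul_left m').trans h)
      rwa [← hm'] at this
    · have := nsmul_div_eq_nsmul_div hg.ne' hn0 hp.ne_zero (c := n / p)
        (by rw [← hn', Nat.mul_div_cancel' (hpg.trans ⟨n', hn'⟩)]) ((hkp.mul_left n').trans h)
      rwa [← hn'] at this

/-- A point of the circle is in at most `φ(gcd m n)` ways a difference of a point of order `m` and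
a point of order `n`. A suitable translation maps the solutions into the points of order
`gcd m n`. -/
lemma card_filter_sub_le {m n : ℕ} (hm : 0 < m) (hn : 0 < n) (w : UnitAddCircle) :
    ((reducedPoints m ×ˢ reducedPoints n).filter fun x => x.1 - x.2 = w).card ≤
      (m.gcd n).totient := by
  classical
  have hg : 0 < m.gcd n := Nat.gcd_pos_of_pos_left _ hm
  set F := (reducedPoints m ×ˢ reducedPoints n).filter fun x => x.1 - x.2 = w with hF
  have hmem : ∀ x ∈ F, addOrderOf x.1 = m ∧ addOrderOf x.2 = n ∧ x.1 - x.2 = w := by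
    intro x hx
    rw [hF, Finset.mem_filter, Finset.mem_product, mem_reducedPoints hm, mem_reducedPoints hn] at hx
    exact ⟨hx.1.1, hx.1.2, hx.2⟩
  rcases F.eq_empty_or_nonempty with h | ⟨x₀, hx₀⟩
  · rw [h]; simp
  obtain ⟨hy₀, hz₀, hw₀⟩ := hmem x₀ hx₀
  obtain ⟨e, he, hep⟩ := exists_torsion_interpolating hm hn hy₀ hz₀
  rw [← card_reducedPoints hg]
  refine Finset.card_le_card_of_injOn (fun x => x.1 - x₀.1 + e) (fun x hx => ?_) ?_
  · obtain ⟨hy, hz, hw⟩ := hmem x hx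
    have hs : x.2 - x₀.2 = x.1 - x₀.1 := by
      rw [sub_eq_iff_eq_add] at hw hw₀
      rw [hw, hw₀]; abel
    have hgs : (m.gcd n) • (x.1 - x₀.1) = 0 := by
      rw [← addOrderOf_dvd_iff_nsmul_eq_zero]
      refine Nat.dvd_gcd ?_ ?_ <;> rw [addOrderOf_dvd_iff_nsmul_eq_zero]
      · rw [nsmul_sub, addOrderOf_dvd_iff_nsmul_eq_zero.1 hy.dvd,
          addOrderOf_dvd_iff_nsmul_eq_zero.1 hy₀.dvd, sub_zero]
      · rw [← hs, nsmul_sub, addOrderOf_dvd_iff_nsmul_eq_zero.1 hz.dvd,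
          addOrderOf_dvd_iff_nsmul_eq_zero.1 hz₀.dvd, sub_zero]
    rw [Finset.mem_coe, mem_reducedPoints hg]
    refine addOrderOf_eq_of_nsmul_and_div_prime_nsmul hg ?_ fun p hp hpg h0 => ?_
    · rw [nsmul_add, hgs, he, add_zero]
    · have hdiv : ∀ {k : ℕ}, m.gcd n ∣ k → (k / p) • (x.1 - x₀.1 + e) = 0 := by
        rintro k ⟨j, rfl⟩
        rw [Nat.mul_comm, Nat.mul_div_assoc _ hpg, mul_nsmul', h0, nsmul_zero]
      have hcontra : ∀ {k : ℕ} {u v : UnitAddCircle}, 0 < k → p ∣ k → addOrderOf u = k →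
          u - v = x.1 - x₀.1 → m.gcd n ∣ k → (k / p) • e = (k / p) • v → False := by
        intro k u v hk hpk hu huv hgk hev
        have h1 := hdiv hgk
        rw [← huv, nsmul_add, hev, ← nsmul_add, sub_add_cancel,
          ← addOrderOf_dvd_iff_nsmul_eq_zero, hu] at h1
        have h2 := Nat.le_of_dvd (Nat.div_pos (Nat.le_of_dvd hk hpk) hp.pos) h1
        exact absurd h2 (not_le.2 (Nat.div_lt_self hk hp.one_lt))
      rcases hep p hp hpg with h | h
      · exact hcontra hm (hpg.trans (Nat.gcd_dvd_left m n)) hy rfl (Nat.gcd_dvd_left m n) h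
      · exact hcontra hn (hpg.trans (Nat.gcd_dvd_right m n)) hz hs (Nat.gcd_dvd_right m n) h
  · intro x hx x' hx' h
    have h1 : x.1 = x'.1 := by simpa using h
    have h2 := (hmem x hx).2.2.trans (hmem x' hx').2.2.symm
    rw [h1] at h2
    exact Prod.ext h1 (sub_right_injective h2)

/-- The pairs of a point of order `m` and a point of order `n` at distance less than `δ`. -/
noncomputable def closePairs (m n : ℕ) (δ : ℝ) : Finset (UnitAddCircle × UnitAddCircle) :=
  open Classical in (reducedPoints m ×ˢ reducedPoints n).filter fun x => ‖x.1 - x.2‖ < δ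

/-- Differences of points of orders `m ≠ n` are nonzero `lcm m n`-torsion points, and at most
`2 δ lcm m n` of these have norm less than `δ`. -/
lemma card_closePairs_le_totient_gcd {m n : ℕ} (hm : 0 < m) (hn : 0 < n) (hmn : m ≠ n) {δ : ℝ}
    (hδ : 0 ≤ δ) :
    ((closePairs m n δ).card : ℝ) ≤ (m.gcd n).totient * (2 * (δ * m.lcm n)) := by
  classical
  set L := m.lcm n with hL
  have hL0 : 0 < L := Nat.lcm_pos hm hn
  have hLr : (0 : ℝ) < L := by exact_mod_cast hL0
  set K : ℤ := ⌊δ * L⌋ with hK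
  have hK0 : 0 ≤ K := Int.floor_nonneg.2 (by positivity)
  set t : Finset UnitAddCircle :=
    ((Finset.Icc (-K) K).erase 0).image fun k : ℤ => (((k : ℝ) / L : ℝ) : UnitAddCircle)
  have hmaps : ∀ x ∈ closePairs m n δ, x.1 - x.2 ∈ t := by
    intro x hx
    simp only [closePairs, Finset.mem_filter, Finset.mem_product, mem_reducedPoints hm,
      mem_reducedPoints hn] at hx
    obtain ⟨⟨h1, h2⟩, h3⟩ := hx
    have hne : x.1 - x.2 ≠ 0 := fun h => hmn (by rw [← h1, ← h2, sub_eq_zero.1 h])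
    have htor : L • (x.1 - x.2) = 0 := by
      have e1 : L • x.1 = 0 := addOrderOf_dvd_iff_nsmul_eq_zero.1 (h1 ▸ Nat.dvd_lcm_left m n)
      have e2 : L • x.2 = 0 := addOrderOf_dvd_iff_nsmul_eq_zero.1 (h2 ▸ Nat.dvd_lcm_right m n)
      rw [nsmul_sub, e1, e2, sub_zero]
    generalize x.1 - x.2 = w at *
    induction w using QuotientAddGroup.induction_on with
    | H r =>
    change ‖((r : ℝ) : UnitAddCircle)‖ < δ at h3
    change L • ((r : ℝ) : UnitAddCircle) = 0 at htor
    change ((r : ℝ) : UnitAddCircle) ≠ 0 at hne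
    change ((r : ℝ) : UnitAddCircle) ∈ t
    rw [UnitAddCircle.norm_eq] at h3
    have hr : ((r - round r : ℝ) : UnitAddCircle) = (r : UnitAddCircle) := by
      rw [AddCircle.coe_sub, sub_eq_self, AddCircle.coe_eq_zero_iff]
      exact ⟨round r, by simp⟩
    rw [← hr] at htor hne ⊢
    generalize r - round r = s at *
    rw [← AddCircle.coe_nsmul, AddCircle.coe_eq_zero_iff] at htor
    obtain ⟨k, hk⟩ := htor
    rw [zsmul_eq_mul, mul_one, nsmul_eq_mul] at hk
    have hks : (k : ℝ) / L = s := by rw [hk]; field_simp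
    refine Finset.mem_image.2 ⟨k, ?_, by rw [hks]⟩
    rw [Finset.mem_erase, Finset.mem_Icc, ← abs_le]
    refine ⟨?_, ?_⟩
    · rintro rfl
      apply hne
      rw [← hks]; simp
    · rw [hK, Int.le_floor]
      push_cast
      rw [hk, abs_mul, abs_of_pos hLr, mul_comm]
      exact mul_le_mul_of_nonneg_right h3.le hLr.le
  have hcard := Finset.card_le_mul_card_image_of_maps_to hmaps (m.gcd n).totient fun w _ =>
    (Finset.card_le_card (fun x hx => by
      simp only [closePairs, Finset.mem_filter] at hx ⊢
      exact ⟨hx.1.1, hx.2⟩)).trans (card_filter_sub_le hm hn w)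
  have ht : (t.card : ℝ) ≤ 2 * (δ * L) := by
    have h1 : t.card ≤ ((Finset.Icc (-K) K).erase 0).card := Finset.card_image_le
    rw [Finset.card_erase_of_mem (by simp [hK0]), Int.card_Icc] at h1
    have h2 : (t.card : ℤ) ≤ 2 * K := by omega
    have h3 : (t.card : ℝ) ≤ 2 * K := by exact_mod_cast h2
    linarith [Int.floor_le (δ * L)]
  calc ((closePairs m n δ).card : ℝ) ≤ (m.gcd n).totient * t.card := by exact_mod_cast hcard
    _ ≤ _ := mul_le_mul_of_nonneg_left ht (Nat.cast_nonneg _)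

/-- Sieving by a divisor `q` of `n` that is at most `δ n` bounds the number of points of order `n`
in a ball of radius `δ`. -/
lemma card_reducedPoints_near_le {n q : ℕ} (hn : 0 < n) (hqn : q ∣ n) {δ : ℝ}
    (hδ : (q : ℝ) ≤ δ * n) (y : UnitAddCircle) [DecidablePred fun z => ‖y - z‖ < δ] :
    (((reducedPoints n).filter fun z => ‖y - z‖ < δ).card : ℝ) * q ≤ 5 * q.totient * (δ * n) := by
  have hq : 0 < q := Nat.pos_of_dvd_of_pos hqn hn
  have hnr : (0 : ℝ) < n := by exact_mod_cast hn
  have hqr : (1 : ℝ) ≤ q := by exact_mod_cast hq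
  have hδ0 : 0 ≤ δ := by
    by_contra h
    nlinarith
  -- a lift of `y` so large that all integers counted below are positive
  obtain ⟨r, hr, hrδ⟩ : ∃ r : ℝ, (r : UnitAddCircle) = y ∧ δ ≤ r := by
    induction y using QuotientAddGroup.induction_on with
    | H s =>
    refine ⟨s + ⌈δ - s⌉, ?_, by linarith [Int.le_ceil (δ - s)]⟩
    have h0 : ((⌈δ - s⌉ : ℝ) : UnitAddCircle) = 0 :=
      (AddCircle.coe_eq_zero_iff _).2 ⟨⌈δ - s⌉, by simp⟩
    rw [AddCircle.coe_add, h0, add_zero]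
  set lo := ⌊n * (r - δ)⌋₊
  set N := ⌊2 * (δ * n)⌋₊ + 2
  have hsub : ((reducedPoints n).filter fun z => ‖y - z‖ < δ) ⊆
      ((Finset.Ico lo (lo + N)).filter q.Coprime).image
        fun b : ℕ => (((b : ℝ) / n : ℝ) : UnitAddCircle) := by
    intro z hz
    rw [Finset.mem_filter] at hz
    obtain ⟨hz1, hz2⟩ := hz
    obtain ⟨a, ha, rfl⟩ := Finset.mem_image.1 hz1
    have han := (Finset.mem_filter.1 ha).2
    rw [← hr, ← AddCircle.coe_sub, UnitAddCircle.norm_eq] at hz2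
    set c := round (r - a / n)
    have hb : |n * r - (a + n * c)| < δ * n := by
      have : n * r - (a + n * c) = (r - a / n - c) * n := by field_simp; ring
      rw [this, abs_mul, abs_of_pos hnr]
      exact mul_lt_mul_of_pos_right hz2 hnr
    rw [abs_lt] at hb
    have hbpos : (0 : ℝ) < a + n * c := by nlinarith
    have hbint : (0 : ℤ) ≤ a + n * c := by exact_mod_cast hbpos.le
    obtain ⟨b, hbeq⟩ := Int.eq_ofNat_of_zero_le hbint
    have hbr : (a : ℝ) + n * c = b := by exact_mod_cast hbeq
    rw [hbr] at hb hbpos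
    refine Finset.mem_image.2 ⟨b, ?_, ?_⟩
    · rw [Finset.mem_filter, Finset.mem_Ico]
      refine ⟨⟨?_, ?_⟩, ?_⟩
      · refine Nat.floor_le_of_le ?_
        linarith
      · have h1 := Nat.lt_floor_add_one (n * (r - δ))
        have h2 := Nat.lt_floor_add_one (2 * (δ * n))
        have : (b : ℝ) < (lo + N : ℕ) := by
          push_cast [lo, N]
          linarith
        exact_mod_cast this
      · refine Nat.Coprime.coprime_dvd_left hqn ?_
        have : Int.gcd (n : ℤ) b = 1 := by
          rw [show (b : ℤ) = a + n * c from hbeq.symm, Int.gcd_add_mul_left_right]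
          exact_mod_cast han
        exact_mod_cast this
    · rw [← hbr, add_div, mul_div_cancel_left₀ _ hnr.ne', AddCircle.coe_add, add_eq_left]
      exact (AddCircle.coe_eq_zero_iff _).2 ⟨c, by simp⟩
  have hcard := ((Finset.card_le_card hsub).trans Finset.card_image_le).trans
    (Nat.Ico_filter_coprime_le lo N hq.ne')
  have hNq : ((N / q : ℕ) : ℝ) ≤ N / q := Nat.cast_div_le
  have hN : (N : ℝ) ≤ 2 * (δ * n) + 2 := by
    push_cast [N]
    linarith [Nat.floor_le (show 0 ≤ 2 * (δ * n) by positivity)]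
  have h1 : (((reducedPoints n).filter fun z => ‖y - z‖ < δ).card : ℝ) ≤
      q.totient * (N / q + 1) := by
    have : (((reducedPoints n).filter fun z => ‖y - z‖ < δ).card : ℝ) ≤
        q.totient * ((N / q : ℕ) + 1) := by exact_mod_cast hcard
    exact this.trans (mul_le_mul_of_nonneg_left (by linarith) (Nat.cast_nonneg _))
  calc _ ≤ (q.totient : ℝ) * (N / q + 1) * q := mul_le_mul_of_nonneg_right h1 (by linarith)
    _ = q.totient * (N + q) := by field_simp
    _ ≤ q.totient * (5 * (δ * n)) := mul_le_mul_of_nonneg_left (by linarith) (Nat.cast_nonneg _)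
    _ = _ := by ring

lemma card_closePairs_mul_le {m n q : ℕ} (hm : 0 < m) (hn : 0 < n) (hqn : q ∣ n) {δ : ℝ}
    (hδ : (q : ℝ) ≤ δ * n) :
    ((closePairs m n δ).card : ℝ) * q ≤ m.totient * (5 * q.totient * (δ * n)) := by
  classical
  have h : (closePairs m n δ).card = ∑ y ∈ reducedPoints m,
      ((reducedPoints n).filter fun z => ‖y - z‖ < δ).card := by
    simp only [closePairs, Finset.card_filter]
    rw [Finset.sum_product]
  rw [h, Nat.cast_sum, Finset.sum_mul, ← card_reducedPoints hm, ← nsmul_eq_mul]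
  exact Finset.sum_le_card_nsmul _ _ _ fun y _ => card_reducedPoints_near_le hn hqn hδ y

/-! ### Measures of overlaps -/

/-- The second moment method: events that are quasi-independent on average, with constant `K`, have a
union of measure at least `1 / K`. -/
lemma le_measureReal_biUnion_of_pairwise_le {Ω ι : Type*} [MeasurableSpace Ω] (μ : Measure Ω)
    [IsFiniteMeasure μ] {A : ι → Set Ω} (hA : ∀ i, MeasurableSet (A i)) (F : Finset ι) {K : ℝ}
    (hK : 0 < K) (hpos : 0 < ∑ i ∈ F, μ.real (A i))
    (h : ∑ i ∈ F, ∑ j ∈ F, μ.real (A i ∩ A j) ≤ K * (∑ i ∈ F, μ.real (A i)) ^ 2) :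
    1 / K ≤ μ.real (⋃ i ∈ F, A i) := by
  classical
  set T := ∑ i ∈ F, μ.real (A i) with hT
  set U := ⋃ i ∈ F, A i with hU
  have hUm : MeasurableSet U := Finset.measurableSet_biUnion F fun i _ => hA i
  have hint : ∀ s : Set Ω, MeasurableSet s → Integrable (s.indicator (1 : Ω → ℝ)) μ := fun s hs =>
    (integrable_const (1 : ℝ)).indicator hs
  -- integrate `2 t f ≤ f² + t² 1_U` for the counting function `f = ∑ 1_{A i}`, with `t = K T`
  set t := K * T with ht
  have hpt : ∀ x, 2 * t * ∑ i ∈ F, (A i).indicator (1 : Ω → ℝ) x ≤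
      ∑ i ∈ F, ∑ j ∈ F, (A i ∩ A j).indicator (1 : Ω → ℝ) x +
        t ^ 2 * U.indicator (1 : Ω → ℝ) x := by
    intro x
    have hsq : ∑ i ∈ F, ∑ j ∈ F, (A i ∩ A j).indicator (1 : Ω → ℝ) x =
        (∑ i ∈ F, (A i).indicator (1 : Ω → ℝ) x) ^ 2 := by
      rw [sq, Finset.sum_mul_sum]
      refine Finset.sum_congr rfl fun i _ => Finset.sum_congr rfl fun j _ => ?_
      rw [Set.inter_indicator_one]; rfl
    rw [hsq]
    by_cases hx : x ∈ U
    · rw [Set.indicator_of_mem hx, Pi.one_apply]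
      nlinarith [sq_nonneg (∑ i ∈ F, (A i).indicator (1 : Ω → ℝ) x - t)]
    · have h0 : ∑ i ∈ F, (A i).indicator (1 : Ω → ℝ) x = 0 := by
        refine Finset.sum_eq_zero fun i hi => Set.indicator_of_notMem (fun hxi => hx ?_) _
        exact Set.mem_biUnion (Finset.mem_coe.2 hi) hxi
      rw [h0, Set.indicator_of_notMem hx]; simp
  have h1 : Integrable (fun x => ∑ i ∈ F, (A i).indicator (1 : Ω → ℝ) x) μ :=
    integrable_finsetSum F fun i _ => hint _ (hA i)
  have h2 : Integrable (fun x => ∑ i ∈ F, ∑ j ∈ F, (A i ∩ A j).indicator (1 : Ω → ℝ) x) μ :=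
    integrable_finsetSum F fun i _ => integrable_finsetSum F fun j _ => hint _ ((hA i).inter (hA j))
  have h3 : Integrable (fun x => t ^ 2 * U.indicator (1 : Ω → ℝ) x) μ := (hint _ hUm).const_mul _
  have hmain := integral_mono (h1.const_mul (2 * t)) (h2.add h3) hpt
  have e1 : ∫ x, 2 * t * ∑ i ∈ F, (A i).indicator (1 : Ω → ℝ) x ∂μ = 2 * t * T := by
    rw [integral_const_mul, integral_finsetSum F fun i _ => hint _ (hA i)]
    simp only [integral_indicator_one (hA _), hT]
  have e2 : ∫ x, ∑ i ∈ F, ∑ j ∈ F, (A i ∩ A j).indicator (1 : Ω → ℝ) x ∂μ =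
      ∑ i ∈ F, ∑ j ∈ F, μ.real (A i ∩ A j) := by
    rw [integral_finsetSum F fun i _ =>
      integrable_finsetSum F fun j _ => hint _ ((hA i).inter (hA j))]
    refine Finset.sum_congr rfl fun i _ => ?_
    rw [integral_finsetSum F fun j _ => hint _ ((hA i).inter (hA j))]
    exact Finset.sum_congr rfl fun j _ => integral_indicator_one ((hA i).inter (hA j))
  have e3 : ∫ x, t ^ 2 * U.indicator (1 : Ω → ℝ) x ∂μ = t ^ 2 * μ.real U := by
    rw [integral_const_mul, integral_indicator_one hUm]
  simp only [Pi.add_apply] at hmain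
  rw [e1, integral_add h2 h3, e2, e3] at hmain
  have hKT : 0 < K * T ^ 2 := by positivity
  rw [div_le_iff₀ hK]
  have : K * T ^ 2 * 1 ≤ K * T ^ 2 * (μ.real U * K) := by
    rw [ht] at hmain; nlinarith
  exact le_of_mul_le_mul_left this hKT

lemma measure_limsup_pos_of_finite_unions {Ω : Type*} [MeasurableSpace Ω] (μ : Measure Ω)
    [IsFiniteMeasure μ] {A : ℕ → Set Ω} (hA : ∀ n, MeasurableSet (A n)) {κ : ℝ} (hκ : 0 < κ)
    (h : ∀ N : ℕ, ∃ F : Finset ℕ, (∀ n ∈ F, N ≤ n) ∧ κ ≤ μ.real (⋃ n ∈ F, A n)) :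
    0 < μ (⋂ N : ℕ, ⋃ n ≥ N, A n) := by
  have hanti : Antitone fun N : ℕ => ⋃ n ≥ N, A n := fun N M hNM =>
    Set.biUnion_subset_biUnion_left fun n hn => le_trans hNM hn
  have hlim := tendsto_measure_iInter_atTop (μ := μ)
    (fun N => (MeasurableSet.biUnion (Set.to_countable {n | n ≥ N})
      fun n _ => hA n).nullMeasurableSet) hanti ⟨0, measure_ne_top _ _⟩
  have hle : ENNReal.ofReal κ ≤ μ (⋂ N : ℕ, ⋃ n ≥ N, A n) := by
    refine ge_of_tendsto hlim (Filter.Eventually.of_forall fun N => ?_)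
    obtain ⟨F, hF, hκF⟩ := h N
    refine (ENNReal.ofReal_le_of_le_toReal hκF).trans (measure_mono ?_)
    exact Set.biUnion_subset_biUnion_left fun n hn => hF n hn
  exact lt_of_lt_of_le (ENNReal.ofReal_pos.2 hκ) hle

lemma volume_real_ball_le (y : UnitAddCircle) {r : ℝ} (hr : 0 ≤ r) :
    volume.real (Metric.ball y r) ≤ 2 * r := by
  rw [measureReal_def, ← measure_congr AddCircle.closedBall_ae_eq_ball,
    AddCircle.volume_closedBall, ENNReal.toReal_ofReal (by positivity)]
  exact min_le_right _ _

lemma volume_real_ball (y : UnitAddCircle) {r : ℝ} (hr : 0 ≤ r) (hr2 : 2 * r ≤ 1) :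
    volume.real (Metric.ball y r) = 2 * r := by
  rw [measureReal_def, ← measure_congr AddCircle.closedBall_ae_eq_ball,
    AddCircle.volume_closedBall, ENNReal.toReal_ofReal (by positivity), min_eq_right hr2]

lemma approxAddOrderOf_eq_biUnion {n : ℕ} (hn : 0 < n) (r : ℝ) :
    approxAddOrderOf UnitAddCircle n r = ⋃ y ∈ reducedPoints n, Metric.ball y r := by
  ext x
  simp only [mem_approx_add_orderOf_iff, Set.mem_iUnion, mem_reducedPoints hn, exists_prop]

lemma volume_real_approxAddOrderOf {n : ℕ} (hn : 0 < n) {r : ℝ} (hr : 0 ≤ r)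
    (hnr : 2 * (n * r) ≤ 1) :
    volume.real (approxAddOrderOf UnitAddCircle n r) = n.totient * (2 * r) := by
  have hn1 : (1 : ℝ) ≤ n := by exact_mod_cast hn
  have h2r : 2 * r ≤ 1 := by nlinarith
  rw [approxAddOrderOf_eq_biUnion hn, measureReal_biUnion_finset]
  · rw [Finset.sum_congr rfl fun y _ => volume_real_ball y hr h2r, Finset.sum_const,
      card_reducedPoints hn, nsmul_eq_mul]
  · intro y hy z hz hyz
    rw [Finset.mem_coe, mem_reducedPoints hn] at hy hz
    refine Metric.ball_disjoint_ball ?_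
    have htor : n • (y - z) = 0 := by
      rw [nsmul_sub, addOrderOf_dvd_iff_nsmul_eq_zero.1 hy.dvd,
        addOrderOf_dvd_iff_nsmul_eq_zero.1 hz.dvd, sub_zero]
    have hfin : IsOfFinAddOrder (y - z) := isOfFinAddOrder_iff_nsmul_eq_zero.2 ⟨n, hn, htor⟩
    have h1 := AddCircle.le_add_order_smul_norm_of_isOfFinAddOrder hfin (sub_ne_zero.2 hyz)
    have h2 : (addOrderOf (y - z) : ℝ) ≤ n := by
      exact_mod_cast Nat.le_of_dvd hn (addOrderOf_dvd_iff_nsmul_eq_zero.2 htor)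
    rw [nsmul_eq_mul] at h1
    rw [dist_eq_norm]
    have h3 : 1 ≤ n * ‖y - z‖ := h1.trans (mul_le_mul_of_nonneg_right h2 (norm_nonneg _))
    have h4 : (n : ℝ) * (r + r) ≤ n * ‖y - z‖ := by linarith
    exact le_of_mul_le_mul_left h4 (by linarith)
  · exact fun y _ => measurableSet_ball

/-- The overlap of two approximation sets, in terms of the number of pairs of close centres. -/
lemma volume_real_inter_le_card_closePairs {m n : ℕ} (hm : 0 < m) (hn : 0 < n) {r s : ℝ}
    (hr : 0 ≤ r) (hs : 0 ≤ s) :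
    volume.real (approxAddOrderOf UnitAddCircle m r ∩ approxAddOrderOf UnitAddCircle n s) ≤
      (closePairs m n (r + s)).card * (2 * min r s) := by
  have hsub : approxAddOrderOf UnitAddCircle m r ∩ approxAddOrderOf UnitAddCircle n s ⊆
      ⋃ x ∈ closePairs m n (r + s), Metric.ball x.1 r ∩ Metric.ball x.2 s := by
    rintro u ⟨hu1, hu2⟩
    rw [approxAddOrderOf_eq_biUnion hm] at hu1
    rw [approxAddOrderOf_eq_biUnion hn] at hu2
    simp only [Set.mem_iUnion, exists_prop] at hu1 hu2 ⊢
    obtain ⟨y, hy, huy⟩ := hu1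
    obtain ⟨z, hz, huz⟩ := hu2
    refine ⟨(y, z), ?_, huy, huz⟩
    rw [closePairs, Finset.mem_filter, Finset.mem_product]
    refine ⟨⟨hy, hz⟩, ?_⟩
    rw [← dist_eq_norm]
    linarith [dist_triangle_left y z u, Metric.mem_ball.1 huy, Metric.mem_ball.1 huz]
  refine (measureReal_mono hsub (measure_ne_top _ _)).trans
    ((measureReal_biUnion_finset_le _ _).trans ?_)
  rw [← nsmul_eq_mul]
  refine Finset.sum_le_card_nsmul _ _ _ fun x _ => ?_
  rw [mul_min_of_nonneg _ _ zero_le_two]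
  exact le_min ((measureReal_mono Set.inter_subset_left (by finiteness)).trans
    (volume_real_ball_le _ hr)) ((measureReal_mono Set.inter_subset_right (by finiteness)).trans
    (volume_real_ball_le _ hs))

lemma volume_real_inter_le {m n : ℕ} (hm : 0 < m) (hn : 0 < n) {r s P : ℝ}
    (hr : 0 ≤ r) (hs : 0 ≤ s) (hP : 0 ≤ P)
    (h : ((closePairs m n (r + s)).card : ℝ) ≤ P * (m.totient * n.totient) * (r + s)) :
    volume.real (approxAddOrderOf UnitAddCircle m r ∩ approxAddOrderOf UnitAddCircle n s) ≤
      4 * P * ((m.totient * r) * (n.totient * s)) := by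
  refine (volume_real_inter_le_card_closePairs hm hn hr hs).trans ?_
  have hmin : 0 ≤ min r s := le_min hr hs
  have hrs : (r + s) * min r s ≤ 2 * (r * s) := by
    rcases le_total r s with h | h
    · rw [min_eq_left h]; nlinarith
    · rw [min_eq_right h]; nlinarith
  calc _ ≤ P * (m.totient * n.totient) * (r + s) * (2 * min r s) :=
        mul_le_mul_of_nonneg_right h (by linarith)
    _ = P * (m.totient * n.totient) * 2 * ((r + s) * min r s) := by ring
    _ ≤ P * (m.totient * n.totient) * 2 * (2 * (r * s)) :=
        mul_le_mul_of_nonneg_left hrs (by positivity)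
    _ = _ := by ring

lemma totient_gcd_mul_totient_lcm {m n : ℕ} (hm : 0 < m) :
    (m.gcd n).totient * (m.lcm n).totient = m.totient * n.totient := by
  have hg : 0 < m.gcd n := Nat.gcd_pos_of_pos_left _ hm
  have h1 := Nat.totient_gcd_mul_totient_mul m n
  have h2 := Nat.totient_gcd_mul_totient_mul (m.gcd n) (m.lcm n)
  rw [Nat.gcd_eq_left ((Nat.gcd_dvd_left m n).trans (Nat.dvd_lcm_left m n)),
    Nat.gcd_mul_lcm] at h2
  exact Nat.eq_of_mul_eq_mul_right hg (h2.symm.trans h1)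

lemma mem_Δ {h n : ℕ} : n ∈ Δ h ↔ 2 ^ 2 ^ h < n ∧ n ≤ 2 ^ 2 ^ (h + 1) := by
  rw [Δ, Finset.mem_Icc, Nat.succ_le_iff]

/-- The bound for `m` and `n` of comparable size: it loses a factor `h' ≈ log log n` against
quasi-independence. -/
lemma exists_near_overlap_le :
    ∃ K : ℝ, 0 < K ∧ ∀ (h h' m n : ℕ) (r s : ℝ), 1 ≤ h' → h ≤ h' → m ∈ Δ h → n ∈ Δ h' → m ≠ n →
      0 ≤ r → 0 ≤ s →
      volume.real (approxAddOrderOf UnitAddCircle m r ∩ approxAddOrderOf UnitAddCircle n s) ≤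
        K * h' * ((m.totient * r) * (n.totient * s)) := by
  obtain ⟨C, hC, hCb⟩ := exists_le_mul_totient
  refine ⟨24 * C, by positivity, fun h h' m n r s h1 hh hm hn hmn hr hs => ?_⟩
  rw [mem_Δ] at hm hn
  have hm0 : 0 < m := pos_of_gt hm.1
  have hn0 : 0 < n := pos_of_gt hn.1
  have hh1 : (1 : ℝ) ≤ h' := by exact_mod_cast h1
  have hL : m.lcm n ≤ 2 ^ 2 ^ (h' + 2) := by
    calc m.lcm n ≤ m * n := Nat.le_of_dvd (by positivity) (Nat.lcm_dvd_mul m n)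
      _ ≤ 2 ^ 2 ^ (h' + 1) * 2 ^ 2 ^ (h' + 1) := by
          refine Nat.mul_le_mul (hm.2.trans ?_) hn.2
          exact Nat.pow_le_pow_right two_pos (Nat.pow_le_pow_right two_pos (by omega))
      _ = 2 ^ 2 ^ (h' + 2) := by rw [← pow_add]; congr 1; ring
  have hLt := hCb (h' + 2) _ (by omega) (Nat.lcm_pos hm0 hn0).ne' hL
  have hcard := card_closePairs_le_totient_gcd hm0 hn0 hmn (add_nonneg hr hs)
  have hφ : ((m.gcd n).totient : ℝ) * (m.lcm n).totient = m.totient * n.totient := by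
    exact_mod_cast totient_gcd_mul_totient_lcm hm0
  refine (volume_real_inter_le (P := 6 * C * h') hm0 hn0 hr hs (by positivity) ?_).trans_eq
    (by ring)
  calc _ ≤ _ := hcard
    _ = (m.gcd n).totient * (2 * (r + s)) * (m.lcm n) := by ring
    _ ≤ (m.gcd n).totient * (2 * (r + s)) * (C * (3 * h') * (m.lcm n).totient) := by
        refine mul_le_mul_of_nonneg_left (hLt.trans ?_) (by positivity)
        push_cast
        refine mul_le_mul_of_nonneg_right (mul_le_mul_of_nonneg_left ?_ hC.le) (by positivity)
        linarith
    _ = 6 * C * h' * ((m.gcd n).totient * (m.lcm n).totient) * (r + s) := by ring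
    _ = _ := by rw [hφ]

/-- Quasi-independence for `n` much larger than `m`, as soon as the intervals around the points of
order `m` are not too short. -/
lemma far_overlap_le {h h' m n : ℕ} {r s : ℝ} (hh : h + 3 ≤ h') (hm : m ∈ Δ h)
    (hn : n ∈ Δ h') (hr : 1 ≤ r * m ^ 3) (hs : 0 ≤ s) :
    volume.real (approxAddOrderOf UnitAddCircle m r ∩ approxAddOrderOf UnitAddCircle n s) ≤
      20 * Real.exp 16 * ((m.totient * r) * (n.totient * s)) := by
  rw [mem_Δ] at hm hn
  have hm0 : 0 < m := pos_of_gt hm.1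
  have hn0 : 0 < n := pos_of_gt hn.1
  have hmr : (0 : ℝ) < m := by exact_mod_cast hm0
  have hr0 : 0 ≤ r := by
    by_contra hneg
    have : r * (m : ℝ) ^ 3 < 0 := mul_neg_of_neg_of_pos (not_le.1 hneg) (by positivity)
    linarith
  obtain ⟨k, rfl⟩ := Nat.exists_eq_add_of_le' (show 3 ≤ h' by omega)
  obtain ⟨q, hqn, hq4, hqφ⟩ :=
    exists_dvd_totient_mul_le (y := 2 ^ k) hn0.ne' hn.2 Nat.one_le_two_pow
  have hq0 : (0 : ℝ) < q := by exact_mod_cast Nat.pos_of_dvd_of_pos hqn hn0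
  have he : ((2 ^ (k + 3 + 1) : ℕ) : ℝ) / (2 ^ k : ℕ) = 16 := by
    push_cast
    rw [div_eq_iff (by positivity)]
    ring
  rw [he] at hqφ
  -- all sizes are compared through `X = 2 ^ 2 ^ (h' - 3)`
  set X : ℕ := 2 ^ 2 ^ k with hX
  have hq2 : q ≤ X ^ 2 := hq4.trans_eq (by
    rw [hX, ← pow_mul, show 4 = 2 ^ 2 by norm_num, ← pow_mul, mul_comm])
  have hm2 : m ≤ X ^ 2 := by
    refine hm.2.trans ?_
    rw [hX, ← pow_mul, ← pow_succ]
    exact Nat.pow_le_pow_right two_pos (Nat.pow_le_pow_right two_pos (by omega))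
  have hn8 : X ^ 8 ≤ n := by
    refine le_trans (le_of_eq ?_) hn.1.le
    rw [hX, ← pow_mul]
    congr 1
    ring
  have hq2r : (q : ℝ) ≤ (X : ℝ) ^ 2 := by exact_mod_cast hq2
  have hm2r : (m : ℝ) ≤ (X : ℝ) ^ 2 := by exact_mod_cast hm2
  have hn8r : (X : ℝ) ^ 8 ≤ n := by exact_mod_cast hn8
  have hδ : (q : ℝ) ≤ (r + s) * n := by
    have h1 : (q : ℝ) * m ^ 3 ≤ n := by
      calc (q : ℝ) * m ^ 3 ≤ X ^ 2 * (X ^ 2) ^ 3 :=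
            mul_le_mul hq2r (pow_le_pow_left₀ hmr.le hm2r 3) (by positivity) (by positivity)
        _ = X ^ 8 := by ring
        _ ≤ n := hn8r
    have h2 : (q : ℝ) * m ^ 3 ≤ r * n * m ^ 3 := by
      refine h1.trans ?_
      nlinarith [mul_le_mul_of_nonneg_right hr (Nat.cast_nonneg n : (0 : ℝ) ≤ n)]
    have h4 : (q : ℝ) ≤ r * n := le_of_mul_le_mul_right h2 (by positivity)
    nlinarith [mul_nonneg hs (Nat.cast_nonneg n : (0 : ℝ) ≤ n)]
  refine (volume_real_inter_le (P := 5 * Real.exp 16) hm0 hn0 hr0 hs (by positivity) ?_).trans_eq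
    (by ring)
  refine le_of_mul_le_mul_right ?_ hq0
  calc _ ≤ _ := card_closePairs_mul_le hm0 hn0 hqn hδ
    _ = m.totient * 5 * (r + s) * (q.totient * n) := by ring
    _ ≤ m.totient * 5 * (r + s) * (Real.exp 16 * n.totient * q) :=
        mul_le_mul_of_nonneg_left hqφ (by positivity)
    _ = _ := by ring

/-! ### Summation over blocks -/

lemma sum_Ico_sum_Δ {M : Type*} [AddCommMonoid M] (f : ℕ → M) {a b : ℕ} (hab : a ≤ b) :
    ∑ h ∈ Finset.Ico a b, ∑ n ∈ Δ h, f n = ∑ n ∈ Finset.Ioc (2 ^ 2 ^ a) (2 ^ 2 ^ b), f n := by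
  induction b, hab using Nat.le_induction with
  | base => simp
  | succ b hab ih =>
    have hΔ : Δ b = Finset.Ioc (2 ^ 2 ^ b) (2 ^ 2 ^ (b + 1)) := by
      ext n; rw [mem_Δ, Finset.mem_Ioc]
    rw [Finset.sum_Ico_succ_top hab, ih, hΔ]
    have hmono : ∀ {x y : ℕ}, x ≤ y → 2 ^ 2 ^ x ≤ 2 ^ 2 ^ y := fun hxy =>
      Nat.pow_le_pow_right two_pos (Nat.pow_le_pow_right two_pos hxy)
    exact Finset.sum_Ioc_consecutive f (hmono hab) (hmono b.le_succ)

lemma exists_mem_Δ {n a : ℕ} (hn : 2 ^ 2 ^ a < n) : ∃ h, a ≤ h ∧ n ∈ Δ h := by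
  have hex : ∃ k, n ≤ 2 ^ 2 ^ k :=
    ⟨n, (Nat.lt_two_pow_self.trans Nat.lt_two_pow_self).le⟩
  have hmin : ∀ j < Nat.find hex, 2 ^ 2 ^ j < n := fun j hj => not_le.1 (Nat.find_min hex hj)
  have hspec := Nat.find_spec hex
  have hlt : a < Nat.find hex := by
    by_contra hle
    have : 2 ^ 2 ^ Nat.find hex ≤ 2 ^ 2 ^ a :=
      Nat.pow_le_pow_right two_pos (Nat.pow_le_pow_right two_pos (not_lt.1 hle))
    omega
  obtain ⟨h, hh⟩ := Nat.exists_eq_succ_of_ne_zero (n := Nat.find hex) (by omega)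
  refine ⟨h, by omega, mem_Δ.2 ⟨hmin h (by omega), ?_⟩⟩
  rwa [hh] at hspec

/-- The total overlap between the blocks `Δ h` and `Δ h'`. -/
noncomputable def blockOverlap (θ : ℕ → ℝ) (h h' : ℕ) : ℝ :=
  ∑ m ∈ Δ h, ∑ n ∈ Δ h', volume.real
    (approxAddOrderOf UnitAddCircle m (θ m / m) ∩ approxAddOrderOf UnitAddCircle n (θ n / n))

lemma blockOverlap_comm (θ : ℕ → ℝ) (h h' : ℕ) : blockOverlap θ h h' = blockOverlap θ h' h := by
  rw [blockOverlap, Finset.sum_comm]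
  simp only [blockOverlap, Set.inter_comm]

lemma S_eq (θ : ℕ → ℝ) (h : ℕ) : S θ h = ∑ n ∈ Δ h, (n.totient : ℝ) * (θ n / n) :=
  Finset.sum_congr rfl fun n _ => by ring

lemma S_nonneg {θ : ℕ → ℝ} (hθ : ∀ n, 0 ≤ θ n) (h : ℕ) : 0 ≤ S θ h :=
  Finset.sum_nonneg fun n _ => by have := hθ n; positivity

lemma exists_blockOverlap_near_le :
    ∃ K : ℝ, 0 < K ∧ ∀ θ : ℕ → ℝ, (∀ n, 0 ≤ θ n) → (∀ n, 2 * θ n ≤ 1) →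
      ∀ h h' : ℕ, 1 ≤ h' → h ≤ h' →
        blockOverlap θ h h' ≤ K * h' * (S θ h * S θ h') + 2 * S θ h := by
  obtain ⟨K, hK, hb⟩ := exists_near_overlap_le
  refine ⟨K, hK, fun θ h0 h2 h h' h1 hh => ?_⟩
  have hr : ∀ n, 0 ≤ θ n / n := fun n => div_nonneg (h0 n) n.cast_nonneg
  rw [S_eq, S_eq, Finset.sum_mul_sum, Finset.mul_sum, Finset.mul_sum, ← Finset.sum_add_distrib]
  refine Finset.sum_le_sum fun m hm => ?_
  have hm0 : 0 < m := pos_of_gt (mem_Δ.1 hm).1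
  have hmr : (0 : ℝ) < m := by exact_mod_cast hm0
  have hterm : ∀ n ∈ Δ h', volume.real (approxAddOrderOf UnitAddCircle m (θ m / m) ∩
      approxAddOrderOf UnitAddCircle n (θ n / n)) ≤
        K * h' * ((m.totient * (θ m / m)) * (n.totient * (θ n / n))) +
          if n = m then 2 * (m.totient * (θ m / m)) else 0 := by
    intro n hn
    have hpos : 0 ≤ K * h' * ((m.totient * (θ m / m)) * (n.totient * (θ n / n))) := by
      have := hr m; have := hr n; positivity
    split_ifs with hnm
    · subst hnm
      rw [Set.inter_self, volume_real_approxAddOrderOf hm0 (hr n)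
        (by rw [mul_div_cancel₀ _ hmr.ne']; exact h2 n)]
      linarith
    · rw [add_zero]
      exact hb h h' m n _ _ h1 hh hm hn (Ne.symm hnm) (hr m) (hr n)
  refine (Finset.sum_le_sum hterm).trans ?_
  rw [Finset.sum_add_distrib, ← Finset.mul_sum, Finset.sum_ite_eq']
  refine add_le_add le_rfl ?_
  have := hr m
  split_ifs
  · exact le_rfl
  · positivity

lemma blockOverlap_far_le {θ : ℕ → ℝ} (h0 : ∀ n, 0 ≤ θ n) (hbd : ∀ n, θ n = 0 ∨ 1 ≤ θ n * n ^ 2)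
    {h h' : ℕ} (hh : h + 3 ≤ h') :
    blockOverlap θ h h' ≤ 20 * Real.exp 16 * (S θ h * S θ h') := by
  have hr : ∀ n, 0 ≤ θ n / n := fun n => div_nonneg (h0 n) n.cast_nonneg
  rw [S_eq, S_eq, Finset.sum_mul_sum, Finset.mul_sum]
  refine Finset.sum_le_sum fun m hm => ?_
  rw [Finset.mul_sum]
  refine Finset.sum_le_sum fun n hn => ?_
  have hm0 : 0 < m := pos_of_gt (mem_Δ.1 hm).1
  have hmr : (0 : ℝ) < m := by exact_mod_cast hm0
  rcases hbd m with hz | hz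
  · have hemp : approxAddOrderOf UnitAddCircle m (θ m / m) = ∅ := by
      rw [hz, zero_div]
      exact Metric.thickening_of_nonpos le_rfl _
    rw [hemp, Set.empty_inter, measureReal_empty]
    have := hr m; have := hr n; positivity
  · refine far_overlap_le hh hm hn (hz.trans_eq ?_) (hr n)
    field_simp

/-- Summing the overlaps: blocks far apart contribute as if independent, and the loss of a factor
`h'` for neighbouring blocks is made up for by `S h' ≤ c / h'`. -/
lemma exists_sum_blockOverlap_le {c : ℝ} (hc : 0 ≤ c) :
    ∃ K : ℝ, 0 < K ∧ ∀ θ : ℕ → ℝ, (∀ n, 0 ≤ θ n) → (∀ n, 2 * θ n ≤ 1) →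
      (∀ n, θ n = 0 ∨ 1 ≤ θ n * n ^ 2) → (∀ h : ℕ, 1 ≤ h → S θ h ≤ c / h) →
      ∀ a b : ℕ, 1 ≤ a → 1 ≤ ∑ h ∈ Finset.Ico a b, S θ h →
        ∑ h ∈ Finset.Ico a b, ∑ h' ∈ Finset.Ico a b, blockOverlap θ h h' ≤
          K * (∑ h ∈ Finset.Ico a b, S θ h) ^ 2 := by
  obtain ⟨K₀, hK₀, hnear⟩ := exists_blockOverlap_near_le
  set K₁ := 20 * Real.exp 16 with hK₁
  have hK₁0 : 0 < K₁ := by positivity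
  set M := K₀ * c + 2
  have hM : 0 < M := by positivity
  refine ⟨K₁ + 10 * M, by positivity, fun θ h0 h2 hbd hslow a b ha hT => ?_⟩
  set T := ∑ h ∈ Finset.Ico a b, S θ h with hTdef
  have hS := S_nonneg h0
  have hordered : ∀ h h' : ℕ, 1 ≤ h → h ≤ h' → blockOverlap θ h h' ≤ K₁ * (S θ h * S θ h') +
      if h' < h + 3 ∧ h < h' + 3 then M * S θ h + M * S θ h' else 0 := by
    intro h h' h1 hh
    have hSS : 0 ≤ K₁ * (S θ h * S θ h') := by have := hS h; have := hS h'; positivity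
    split_ifs with hd
    · have hpos : (0 : ℝ) < h' := by exact_mod_cast (by omega : 0 < h')
      have hs' : h' * S θ h' ≤ c := by
        have := hslow h' (by omega)
        rwa [le_div_iff₀ hpos, mul_comm] at this
      have h3 : K₀ * S θ h * (h' * S θ h') ≤ K₀ * S θ h * c :=
        mul_le_mul_of_nonneg_left hs' (mul_nonneg hK₀.le (hS h))
      have h4 := hnear θ h0 h2 h h' (by omega) hh
      have h5 : 0 ≤ M * S θ h' := mul_nonneg hM.le (hS h')
      have h6 : M * S θ h = K₀ * S θ h * c + 2 * S θ h := by ring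
      have h7 : K₀ * h' * (S θ h * S θ h') = K₀ * S θ h * (h' * S θ h') := by ring
      linarith
    · rw [add_zero]
      exact blockOverlap_far_le h0 hbd (by omega)
  have hany : ∀ h h' : ℕ, 1 ≤ h → 1 ≤ h' → blockOverlap θ h h' ≤ K₁ * (S θ h * S θ h') +
      if h' < h + 3 ∧ h < h' + 3 then M * S θ h + M * S θ h' else 0 := by
    intro h h' h1 h1'
    rcases le_total h h' with hh | hh
    · exact hordered h h' h1 hh
    · have := hordered h' h h1' hh
      rw [blockOverlap_comm, mul_comm (S θ h')] at this
      exact this.trans_eq (congrArg _ (if_congr and_comm (add_comm _ _) rfl))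
  have hcount : ∑ h ∈ Finset.Ico a b, ∑ h' ∈ Finset.Ico a b,
      (if h' < h + 3 ∧ h < h' + 3 then M * S θ h else 0) ≤ 5 * M * T := by
    rw [hTdef, Finset.mul_sum]
    refine Finset.sum_le_sum fun h _ => ?_
    rw [← Finset.sum_filter, Finset.sum_const, nsmul_eq_mul, mul_assoc 5]
    refine mul_le_mul_of_nonneg_right ?_ (mul_nonneg hM.le (hS h))
    have hsub : (Finset.Ico a b).filter (fun h' => h' < h + 3 ∧ h < h' + 3) ⊆
        Finset.Icc (h - 2) (h + 2) := by
      intro x hx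
      rw [Finset.mem_filter] at hx
      rw [Finset.mem_Icc]
      omega
    have := Finset.card_le_card hsub
    rw [Nat.card_Icc] at this
    exact_mod_cast this.trans (by omega)
  have hsplit : ∑ h ∈ Finset.Ico a b, ∑ h' ∈ Finset.Ico a b,
      (if h' < h + 3 ∧ h < h' + 3 then M * S θ h + M * S θ h' else 0) ≤ 10 * M * T := by
    have hsym : ∑ h ∈ Finset.Ico a b, ∑ h' ∈ Finset.Ico a b,
        (if h' < h + 3 ∧ h < h' + 3 then M * S θ h' else 0) ≤ 5 * M * T := by
      rw [Finset.sum_comm]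
      simpa only [and_comm] using hcount
    have hadd : ∀ h h' : ℕ, (if h' < h + 3 ∧ h < h' + 3 then M * S θ h + M * S θ h' else 0) =
        (if h' < h + 3 ∧ h < h' + 3 then M * S θ h else 0) +
          if h' < h + 3 ∧ h < h' + 3 then M * S θ h' else 0 := by
      intro h h'; split_ifs <;> simp
    simp only [hadd, Finset.sum_add_distrib]
    linarith
  calc _ ≤ ∑ h ∈ Finset.Ico a b, ∑ h' ∈ Finset.Ico a b, (K₁ * (S θ h * S θ h') +
        if h' < h + 3 ∧ h < h' + 3 then M * S θ h + M * S θ h' else 0) := by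
        refine Finset.sum_le_sum fun h hh => Finset.sum_le_sum fun h' hh' => ?_
        rw [Finset.mem_Ico] at hh hh'
        exact hany h h' (by omega) (by omega)
    _ = K₁ * (T * T) + ∑ h ∈ Finset.Ico a b, ∑ h' ∈ Finset.Ico a b,
        (if h' < h + 3 ∧ h < h' + 3 then M * S θ h + M * S θ h' else 0) := by
        simp only [Finset.sum_add_distrib]
        rw [hTdef, Finset.sum_mul_sum, Finset.mul_sum]
        simp only [Finset.mul_sum]
    _ ≤ K₁ * (T * T) + 10 * M * T := by linarith
    _ ≤ (K₁ + 10 * M) * T ^ 2 := by nlinarith [mul_nonneg hM.le (sub_nonneg.2 hT)]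

/-- Positive measure of the limsup set, for functions `θ` whose values are either zero or neither
too small nor too large. -/
lemma volume_limsup_pos {θ : ℕ → ℝ} {c : ℝ} (hc : 0 ≤ c) (h0 : ∀ n, 0 ≤ θ n)
    (h2 : ∀ n, 2 * θ n ≤ 1) (hbd : ∀ n, θ n = 0 ∨ 1 ≤ θ n * n ^ 2)
    (hslow : ∀ h : ℕ, 1 ≤ h → S θ h ≤ c / h)
    (hdiv : ∀ a : ℕ, ∃ b, 1 ≤ ∑ h ∈ Finset.Ico a b, S θ h) :
    0 < volume (⋂ N : ℕ, ⋃ n ≥ N, approxAddOrderOf UnitAddCircle n (θ n / n)) := by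
  obtain ⟨K, hK, hsum⟩ := exists_sum_blockOverlap_le hc
  have hmeas : ∀ n, MeasurableSet (approxAddOrderOf UnitAddCircle n (θ n / n)) :=
    fun n => Metric.isOpen_thickening.measurableSet
  refine measure_limsup_pos_of_finite_unions volume hmeas (one_div_pos.2 hK) fun N => ?_
  obtain ⟨b, hb⟩ := hdiv (N + 1)
  have hab : N + 1 ≤ b := by
    by_contra h
    rw [Finset.Ico_eq_empty (by omega), Finset.sum_empty] at hb
    norm_num at hb
  refine ⟨Finset.Ioc (2 ^ 2 ^ (N + 1)) (2 ^ 2 ^ b), fun n hn => ?_, ?_⟩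
  · have h1 : N + 1 < 2 ^ 2 ^ (N + 1) := Nat.lt_two_pow_self.trans Nat.lt_two_pow_self
    rw [Finset.mem_Ioc] at hn
    omega
  · have hT : ∑ n ∈ Finset.Ioc (2 ^ 2 ^ (N + 1)) (2 ^ 2 ^ b),
        volume.real (approxAddOrderOf UnitAddCircle n (θ n / n)) =
          2 * ∑ h ∈ Finset.Ico (N + 1) b, S θ h := by
      rw [← sum_Ico_sum_Δ _ hab, Finset.mul_sum]
      refine Finset.sum_congr rfl fun h _ => ?_
      rw [S_eq, Finset.mul_sum]
      refine Finset.sum_congr rfl fun n hn => ?_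
      have hn0 : 0 < n := pos_of_gt (mem_Δ.1 hn).1
      have hnr : (n : ℝ) ≠ 0 := by exact_mod_cast hn0.ne'
      rw [volume_real_approxAddOrderOf hn0 (div_nonneg (h0 n) n.cast_nonneg)
        (by rw [mul_div_cancel₀ _ hnr]; exact h2 n)]
      ring
    refine le_measureReal_biUnion_of_pairwise_le volume hmeas _ hK ?_ ?_
    · rw [hT]; linarith
    · rw [hT]
      calc _ = ∑ h ∈ Finset.Ico (N + 1) b, ∑ h' ∈ Finset.Ico (N + 1) b, blockOverlap θ h h' := by
            refine (sum_Ico_sum_Δ _ hab).symm.trans (Finset.sum_congr rfl fun h _ => ?_)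
            simp only [blockOverlap]
            refine Eq.trans (Finset.sum_congr rfl fun m _ => ?_) Finset.sum_comm
            rw [sum_Ico_sum_Δ _ hab]
        _ ≤ K * (∑ h ∈ Finset.Ico (N + 1) b, S θ h) ^ 2 :=
            hsum θ h0 h2 hbd hslow (N + 1) b (by omega) hb
        _ ≤ _ := by
            refine mul_le_mul_of_nonneg_left ?_ hK.le
            nlinarith

/-! ### Truncation and passage to the limsup set -/

/-- Truncation: a function satisfying the hypotheses of the theorem dominates one that still
satisfies them, has `θ n ≤ 1 / 2`, and does not take tiny nonzero values. The upper bound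
is available because `ψ(n) φ(n) / n ≤ c / h` and `n / φ(n) ≪ h` on `Δ h`. -/
lemma exists_truncation {ψ : ℕ → ℝ} (hψ : ∀ n : ℕ, 1 ≤ n → 0 ≤ ψ n)
    (hdiv : Filter.Tendsto
      (fun N : ℕ => ∑ n ∈ Finset.Icc 1 N, ψ n * (Nat.totient n : ℝ) / (n : ℝ))
      Filter.atTop Filter.atTop)
    {c : ℝ} (hc : 0 ≤ c) (hslow : ∀ h : ℕ, 1 ≤ h → S ψ h ≤ c / h) :
    ∃ θ : ℕ → ℝ, (∀ n, 0 ≤ θ n) ∧ (∀ n, 2 * θ n ≤ 1) ∧ (∀ n, θ n = 0 ∨ 1 ≤ θ n * n ^ 2) ∧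
      (∀ n, θ n ≠ 0 → 4 < n ∧ θ n ≤ ψ n) ∧ (∀ h : ℕ, 1 ≤ h → S θ h ≤ c / h) ∧
      ∀ a : ℕ, ∃ b, 1 ≤ ∑ h ∈ Finset.Ico a b, S θ h := by
  classical
  obtain ⟨C, hC, hφ⟩ := exists_le_mul_totient
  have hbound : ∀ n : ℕ, 4 < n → ψ n ≤ 2 * c * C := by
    intro n hn
    obtain ⟨h, h1, hnh⟩ := exists_mem_Δ (a := 1) (n := n) (by simpa using hn)
    have hh : (1 : ℝ) ≤ h := by exact_mod_cast h1
    have hn0 : (0 : ℝ) < n := by exact_mod_cast (by omega : 0 < n)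
    have hφ0 : (0 : ℝ) < n.totient := by exact_mod_cast Nat.totient_pos.2 (by omega)
    have hterm : ψ n * n.totient / n ≤ c / h := by
      refine le_trans ?_ (hslow h h1)
      refine Finset.single_le_sum (f := fun n : ℕ => ψ n * (n.totient : ℝ) / n)
        (fun k hk => ?_) hnh
      have := hψ k (pos_of_gt (mem_Δ.1 hk).1)
      positivity
    have hnφ := hφ (h + 1) n (by omega) (by omega) (mem_Δ.1 hnh).2
    push_cast at hnφ
    rw [div_le_div_iff₀ hn0 (by linarith)] at hterm
    have h3 : c * n ≤ c * (C * (2 * h) * n.totient) := by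
      refine mul_le_mul_of_nonneg_left (hnφ.trans ?_) hc
      refine mul_le_mul_of_nonneg_right (mul_le_mul_of_nonneg_left ?_ hC.le) hφ0.le
      linarith
    have h4 : ψ n * (n.totient * h) ≤ 2 * c * C * (n.totient * h) := by nlinarith
    exact le_of_mul_le_mul_right h4 (by positivity)
  -- `ε` is chosen so that `ε ψ n ≤ 1 / 2` for `n > 4`
  set ε : ℝ := 1 / (2 * (2 * c * C + 1)) with hε
  have hD : 0 < 2 * c * C + 1 := by positivity
  have hε0 : 0 < ε := by positivity
  have hε1 : ε ≤ 1 := by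
    rw [hε, div_le_one (by positivity)]
    have : 0 ≤ 2 * c * C := by positivity
    linarith
  set θ : ℕ → ℝ := fun n => if 4 < n ∧ 1 ≤ ε * ψ n * n ^ 2 then ε * ψ n else 0 with hθ
  have hθ0 : ∀ n, 0 ≤ θ n := by
    intro n
    simp only [hθ]
    split_ifs with h
    · exact mul_nonneg hε0.le (hψ n (by omega))
    · exact le_rfl
  have hθψ : ∀ n, 1 ≤ n → θ n ≤ ψ n := by
    intro n hn
    have := hψ n hn
    simp only [hθ]
    split_ifs with h
    · nlinarith
    · exact this
  refine ⟨θ, hθ0, fun n => ?_, fun n => ?_, fun n hn => ?_, fun h h1 => ?_, fun a => ?_⟩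
  · simp only [hθ]
    split_ifs with h
    · have h1 : ε * ψ n ≤ ε * (2 * c * C + 1) :=
        mul_le_mul_of_nonneg_left (by linarith [hbound n h.1]) hε0.le
      have h2 : ε * (2 * c * C + 1) = 1 / 2 := by rw [hε]; field_simp
      linarith
    · norm_num
  · simp only [hθ]
    split_ifs with h
    · exact Or.inr h.2
    · exact Or.inl rfl
  · have h4 : 4 < n := by
      by_contra h
      exact hn (if_neg fun h' => h h'.1)
    exact ⟨h4, hθψ n (by omega)⟩
  · refine le_trans (Finset.sum_le_sum fun n hn => ?_) (hslow h h1)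
    have := hθψ n (pos_of_gt (mem_Δ.1 hn).1)
    gcongr
  · -- the discarded terms are at most `1 / n²`, so a tail of the divergent series survives
    set a' := a + 1
    set A := ∑ n ∈ Finset.Icc 1 (2 ^ 2 ^ a'), ψ n * (Nat.totient n : ℝ) / (n : ℝ)
    obtain ⟨N, hN⟩ := Filter.eventually_atTop.1 (hdiv.eventually_ge_atTop (2 / ε + A))
    set b := max N a'
    have hab : a' ≤ b := le_max_right _ _
    have hNb : N ≤ 2 ^ 2 ^ b :=
      (le_max_left N a').trans (Nat.lt_two_pow_self.trans Nat.lt_two_pow_self).le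
    have hpow : 2 ^ 2 ^ a' ≤ 2 ^ 2 ^ b :=
      Nat.pow_le_pow_right two_pos (Nat.pow_le_pow_right two_pos hab)
    have hpow4 : 4 ≤ 2 ^ 2 ^ a' :=
      calc 4 = 2 ^ 2 ^ 1 := by norm_num
        _ ≤ _ := Nat.pow_le_pow_right two_pos (Nat.pow_le_pow_right two_pos (by omega))
    set F : Finset ℕ := Finset.Ioc (2 ^ 2 ^ a') (2 ^ 2 ^ b) with hF
    refine ⟨b, ?_⟩
    have hsplit : A + ∑ n ∈ F, ψ n * (n.totient : ℝ) / n =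
        ∑ n ∈ Finset.Icc 1 (2 ^ 2 ^ b), ψ n * (n.totient : ℝ) / n := by
      have e : ∀ k : ℕ, Finset.Icc 1 k = Finset.Ioc 0 k := fun k => by
        ext x; rw [Finset.mem_Icc, Finset.mem_Ioc]; omega
      simp only [A, e]
      exact Finset.sum_Ioc_consecutive _ (Nat.zero_le _) hpow
    have hlow : 2 / ε ≤ ∑ n ∈ F, ψ n * (n.totient : ℝ) / n := by
      linarith [hN _ hNb]
    have hterm : ∀ n ∈ F,
        ε * (ψ n * (n.totient : ℝ) / n) - ((n : ℝ) ^ 2)⁻¹ ≤ θ n * (n.totient : ℝ) / n := by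
      intro n hn
      rw [hF, Finset.mem_Ioc] at hn
      have hn0 : (0 : ℝ) < n := by exact_mod_cast (by omega : 0 < n)
      have hψn := hψ n (by omega)
      simp only [hθ]
      split_ifs with h
      · have : 0 ≤ ((n : ℝ) ^ 2)⁻¹ := by positivity
        have e : ε * (ψ n * (n.totient : ℝ) / n) = ε * ψ n * n.totient / n := by ring
        linarith
      · have h1 : ε * ψ n * n ^ 2 ≤ 1 := by
          by_contra hcon
          exact h ⟨by omega, (not_le.1 hcon).le⟩
        have h2 : ε * ψ n ≤ ((n : ℝ) ^ 2)⁻¹ := by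
          rw [← one_div, le_div_iff₀ (by positivity)]; exact h1
        have h3 : (n.totient : ℝ) / n ≤ 1 := by
          rw [div_le_one hn0]; exact_mod_cast n.totient_le
        have h4 : ε * ψ n * (n.totient / n) ≤ ε * ψ n * 1 :=
          mul_le_mul_of_nonneg_left h3 (by positivity)
        have e : ε * (ψ n * (n.totient : ℝ) / n) = ε * ψ n * (n.totient / n) := by ring
        rw [e, zero_mul, zero_div]
        linarith
    have hinv : ∑ n ∈ F, ((n : ℝ) ^ 2)⁻¹ ≤ 1 := by
      refine (sum_Ioc_inv_sq_le_sub (α := ℝ) (by omega) hpow).trans ?_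
      have h1 : (((2 ^ 2 ^ a' : ℕ) : ℝ))⁻¹ ≤ 1 :=
        inv_le_one_of_one_le₀ (by exact_mod_cast (by omega : 1 ≤ 2 ^ 2 ^ a'))
      have h2 : 0 ≤ (((2 ^ 2 ^ b : ℕ) : ℝ))⁻¹ := by positivity
      linarith
    calc (1 : ℝ) ≤ ε * (2 / ε) - 1 := by rw [mul_div_cancel₀ _ hε0.ne']; norm_num
      _ ≤ ε * ∑ n ∈ F, ψ n * (n.totient : ℝ) / n -
          ∑ n ∈ F, ((n : ℝ) ^ 2)⁻¹ :=
          sub_le_sub (mul_le_mul_of_nonneg_left hlow hε0.le) hinv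
      _ ≤ ∑ n ∈ F, θ n * (n.totient : ℝ) / n := by
          rw [Finset.mul_sum, ← Finset.sum_sub_distrib]
          exact Finset.sum_le_sum hterm
      _ = ∑ h ∈ Finset.Ico a' b, S θ h := (sum_Ico_sum_Δ _ hab).symm
      _ ≤ ∑ h ∈ Finset.Ico a b, S θ h :=
          Finset.sum_le_sum_of_subset_of_nonneg
            (Finset.Ico_subset_Ico (Nat.le_succ a) le_rfl) fun h _ _ => S_nonneg hθ0 h

lemma mem_E_of_norm_lt {ψ : ℕ → ℝ} {n m : ℕ} (hn : 1 < n) (hm : m < n) (hmn : m.gcd n = 1)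
    {x : UnitAddCircle} (hx : ‖x - ((m / n : ℝ) : UnitAddCircle)‖ < ψ n / n) : x ∈ E ψ n := by
  have hm1 : 1 ≤ m := by
    by_contra h
    have : m = 0 := by omega
    subst this
    rw [Nat.gcd_zero_left] at hmn
    omega
  simp only [E, Set.mem_iUnion]
  refine ⟨m, ⟨hm1, hm.le, hmn⟩, ?_⟩
  induction x using QuotientAddGroup.induction_on with
  | H r =>
  change ‖((r : ℝ) : UnitAddCircle) - _‖ < _ at hx
  rw [← AddCircle.coe_sub, UnitAddCircle.norm_eq, abs_lt] at hx
  set k := round (r - m / n)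
  refine ⟨r - k, ⟨?_, ?_⟩, ?_⟩
  · rw [sub_div]; linarith
  · rw [add_div]; linarith
  · have hk : ((k : ℝ) : UnitAddCircle) = 0 := (AddCircle.coe_eq_zero_iff _).2 ⟨k, by simp⟩
    change ((r - k : ℝ) : UnitAddCircle) = (r : UnitAddCircle)
    rw [AddCircle.coe_sub, hk, sub_zero]

lemma infinite_coprimeSolutions {ψ : ℕ → ℝ} {x : ℝ} (hx : (x : UnitAddCircle) ∈ W ψ) :
    (coprimeSolutions ψ x).Infinite := by
  have hsol : ∀ N : ℕ, 1 ≤ N → ∃ p ∈ coprimeSolutions ψ x, N ≤ p.2 := by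
    intro N hN
    simp only [W, Set.mem_iInter, Set.mem_iUnion, E] at hx
    obtain ⟨n, hNn, a, ⟨-, -, ha⟩, t, ⟨ht1, ht2⟩, htx⟩ := hx N hN
    have hn : (0 : ℝ) < n := by exact_mod_cast hN.trans hNn
    change (t : UnitAddCircle) = (x : UnitAddCircle) at htx
    rw [← sub_eq_zero, ← AddCircle.coe_sub, AddCircle.coe_eq_zero_iff] at htx
    obtain ⟨k, hk⟩ := htx
    rw [zsmul_eq_mul, mul_one] at hk
    rw [div_lt_iff₀ hn] at ht1
    rw [lt_div_iff₀ hn] at ht2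
    refine ⟨(a + n * (-k), n), ⟨hN.trans hNn, ?_, ?_⟩, hNn⟩
    · change Int.gcd (a + n * (-k)) n = 1
      rw [Int.gcd_add_mul_left_left]
      exact_mod_cast ha
    · have hxt : x = t - k := by linarith
      change |(n : ℝ) * x - ((a + n * (-k) : ℤ) : ℝ)| < ψ n
      rw [hxt, abs_lt]
      push_cast
      constructor <;> nlinarith
  intro hfin
  obtain ⟨B, hB⟩ := (hfin.image Prod.snd).bddAbove
  obtain ⟨p, hp, hpB⟩ := hsol (B + 1) (by omega)
  have := hB (Set.mem_image_of_mem _ hp)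
  omega

lemma ae_coe_mem_of_ae_mem {s : Set UnitAddCircle} (h : ∀ᵐ x : UnitAddCircle, x ∈ s) :
    ∀ᵐ x : ℝ, (x : UnitAddCircle) ∈ s := by
  rw [← Measure.restrict_univ (μ := (volume : Measure ℝ)), ← iUnion_Ioc_intCast ℝ,
    ae_restrict_iUnion_iff]
  exact fun k => (UnitAddCircle.measurePreserving_mk (k : ℝ)).quasiMeasurePreserving.ae h

end DuffinSchaeffer

open DuffinSchaeffer in
theorem theorem1 (ψ : ℕ → ℝ) (hψ : ∀ n : ℕ, 1 ≤ n → 0 ≤ ψ n)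
    (hdiv : Filter.Tendsto
      (fun N : ℕ => ∑ n ∈ Finset.Icc 1 N, ψ n * (Nat.totient n : ℝ) / (n : ℝ))
      Filter.atTop Filter.atTop)
    (hslow : ∃ c : ℝ, ∀ h : ℕ, 1 ≤ h → DuffinSchaeffer.S ψ h ≤ c / (h : ℝ)) :
    volume (DuffinSchaeffer.W ψ) = 1 ∧
      ∀ᵐ x : ℝ ∂volume, (DuffinSchaeffer.coprimeSolutions ψ x).Infinite := by
  obtain ⟨c, hc⟩ := hslow
  have hc0 : 0 ≤ c := by
    have h1 : 0 ≤ S ψ 1 := Finset.sum_nonneg fun n hn => by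
      have := hψ n (pos_of_gt (mem_Δ.1 hn).1)
      positivity
    simpa using h1.trans (hc 1 le_rfl)
  obtain ⟨θ, h0, h2, hbd, hθψ, hslowθ, hdivθ⟩ := exists_truncation hψ hdiv hc0 hc
  have hpos := volume_limsup_pos hc0 h0 h2 hbd hslowθ hdivθ
  have hlim : Filter.Tendsto (fun n : ℕ => θ n / n) Filter.atTop (nhds 0) := by
    refine squeeze_zero (fun n => div_nonneg (h0 n) n.cast_nonneg) (fun n => ?_)
      (tendsto_one_div_atTop_nhds_zero_nat (𝕜 := ℝ))
    exact div_le_div_of_nonneg_right (by linarith [h0 n, h2 n]) n.cast_nonneg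
  have hsub : (⋂ N : ℕ, ⋃ n ≥ N, approxAddOrderOf UnitAddCircle n (θ n / n)) ⊆
      addWellApproximable UnitAddCircle (fun n => θ n / n) := by
    intro x hx
    rw [mem_add_wellApproximable_iff, ← Nat.cofinite_eq_atTop, Filter.cofinite.blimsup_set_eq,
      Set.mem_ofPred_eq]
    refine Set.infinite_of_not_bddAbove fun ⟨B, hB⟩ => ?_
    obtain ⟨n, hn, hxn⟩ := Set.mem_iUnion₂.1 (Set.mem_iInter.1 hx (B + 1))
    have : n ≤ B := hB ⟨by omega, hxn⟩
    omega
  have hfull : ∀ᵐ x, x ∈ addWellApproximable UnitAddCircle (fun n => θ n / n) := by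
    refine (AddCircle.addWellApproximable_ae_empty_or_univ _ hlim).resolve_left fun hnull => ?_
    refine hpos.ne' (measure_mono_null hsub ?_)
    exact measure_eq_zero_iff_ae_notMem.2 hnull
  have hW : ∀ᵐ x, x ∈ W ψ := by
    filter_upwards [hfull] with x hx
    rw [UnitAddCircle.mem_addWellApproximable_iff] at hx
    simp only [W, Set.mem_iInter]
    intro N _
    obtain ⟨n, ⟨m, hmn, hgcd, hlt⟩, hn⟩ := hx.exists_gt N
    have hne : θ n ≠ 0 := by
      intro h
      rw [h, zero_div] at hlt
      exact absurd hlt (not_lt.2 (norm_nonneg _))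
    obtain ⟨hn4, hle⟩ := hθψ n hne
    refine Set.mem_iUnion₂.2 ⟨n, hn.le, mem_E_of_norm_lt (by omega) hmn hgcd (hlt.trans_le ?_)⟩
    exact div_le_div_of_nonneg_right hle n.cast_nonneg
  refine ⟨?_, ?_⟩
  · exact (measure_congr (Filter.eventuallyEq_univ.2 hW)).trans UnitAddCircle.measure_univ
  · filter_upwards [ae_coe_mem_of_ae_mem hW] with x hx
    exact infinite_coprimeSolutions hx
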